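/- Let $\mathbb{F}_q$ be a finite field of characteristic $p>3$, let $\mathcal{O}=\mathbb{F}_q[t]$, $K=\mathbb{F}_q(t)$ and $K_\infty=\mathbb{F}_q((t^{-1}))$, with the absolute value $|\alpha|=q^M$ if $\alpha=\sum_{i\le M}a_it^i$ with $a_M\neq 0$ (and $|0|=0$), and with the Haar measure that gives $\mathbb{T}=\{\alpha\in K_\infty: |\alpha|<1\}$ measure $1$. Put $|\boldsymbol{x}|=\max_i|x_i|$ on $K_\infty^n$, where $n\ge 1$, and use the product measure there. Let $\psi\left(\sum_{i\le M} a_it^i\right)=\exp\left(2\pi i\,\mathrm{Tr}_{\mathbb{F}_q/\mathbb{F}_p}(a_{-1})/p\right)$. Let $F\in\mathcal{O}[x_1,\dots,x_n]$ be a non-singular cubic form with Hessian matrix $H(\boldsymbol{x})$. Let $F^*\in\mathcal{O}[x_1,\dots,x_n]$ be its dual form, i.e. the primitive form, unique up to a factor in $\mathbb{F}_q^\times$, that generates the ideal of the dual variety of $\{F=0\}\subset\mathbb{P}^{n-1}$, which is the closure of the image of $\{F=0\}$ under $\boldsymbol{x}\mapsto\nabla F(\boldsymbol{x})$. Let $\omega$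 be the indicator function of a ball $\{\boldsymbol{x}\in K_\infty^n: |\boldsymbol{x}-\boldsymbol{x}_0|<1\}$, where $\boldsymbol{x}_0\in K_\infty^n$ and $|\boldsymbol{x}_0|\le 1$, and assume that $\det H(\boldsymbol{x})\ne 0$ for all $\boldsymbol{x}$ in this ball. For $\Gamma\in\mathbb{Z}$ and $\boldsymbol{w}\in K_\infty^n$ define $$J^\Gamma_{F,\omega}(\boldsymbol{w})=\int_{|\gamma|<q^\Gamma}\int_{K_\infty^n}\omega(\boldsymbol{x})\,\psi(\gamma F(\boldsymbol{x})+\boldsymbol{w}\cdot\boldsymbol{x})\,d\boldsymbol{x}\,d\gamma .$$ Then there is a constant $C$, depending on $F$, $F^*$ and $\omega$ (hence on $q$ and $n$) but not on $\Gamma$ or $\boldsymbol{w}$, such that for all $\Gamma\in\mathbb{Z}$ and all $\boldsymbol{w}\in K_\infty^n$ we have $J^\Gamma_{F,\omega}(\boldsymbol{w})=0$ unless $$|F^*(\boldsymbol{w})|\le C\left(1+|\boldsymbol{w}|^{\deg F^*-1}\right).$$ -/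

import Mathlib

open scoped LaurentSeries Polynomial Topology

namespace FFCubic

noncomputable section

/-! ### The local field at infinity

For a finite field `k` with `q` elements, the field `k((t⁻¹))` is realised as `k⸨X⸩` with
`X = t⁻¹`. Thus the coefficient of `t ^ i` in `α` is `α.coeff (-i)`. The topology is Mathlib's
`X`-adic topology. -/

section LocalField

variable (k : Type*) [Field k]

/-- The element `t = X⁻¹` of `k((t⁻¹))`. -/
def tInf : k⸨X⸩ := HahnSeries.single (-1 : ℤ) (1 : k)

/-- The embedding of `k[t]` into `k((t⁻¹))`, sending `t` to `t`. -/
def polyEmb : k[X] →+* k⸨X⸩ :=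
  Polynomial.eval₂RingHom (HahnSeries.C : k →+* k⸨X⸩) (tInf k)

variable {k}

open Classical in
/-- The absolute value on `k((t⁻¹))`: `|α| = q ^ M` if `t ^ M` is the highest power of `t` occurring
in `α ≠ 0` (so that `M` is minus the `X`-adic order of `α`), and `|0| = 0`. -/
def absInf (α : k⸨X⸩) : ℝ :=
  if α = 0 then 0 else (Nat.card k : ℝ) ^ (-(HahnSeries.order α))

/-- The maximum norm on `k((t⁻¹))ⁿ`. -/
def supNorm {n : ℕ} (x : Fin n → k⸨X⸩) : ℝ := ⨆ i, absInf (x i)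

variable (k) in
/-- The unit ball `𝕋 = {α : |α| < 1}`. -/
def unitBall : Set k⸨X⸩ := {α | absInf α < 1}

theorem mem_unitBall_iff [Finite k] (α : k⸨X⸩) :
    α ∈ unitBall k ↔ ∀ m : ℤ, m < 1 → α.coeff m = 0 := by
  have hq : (1 : ℝ) < Nat.card k := by exact_mod_cast Finite.one_lt_card
  by_cases h : α = 0
  · simp [unitBall, absInf, h]
  · have h1 : absInf α < 1 ↔ 0 < HahnSeries.order α := by
      rw [absInf, if_neg h]
      constructor
      · intro h2
        by_contra h3
        exact absurd h2 (not_lt.2 (one_le_zpow₀ hq.le (by omega)))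
      · intro h2
        exact zpow_lt_one_of_neg₀ hq (by omega)
    rw [unitBall, Set.mem_ofPred_eq, h1]
    constructor
    · intro h2 m hm
      exact HahnSeries.coeff_eq_zero_of_lt_order (by omega)
    · intro h2
      by_contra h3
      exact h (HahnSeries.coeff_order_eq_zero.1 (h2 _ (by omega)))

theorem unitBall_eq_valuation [Finite k] :
    unitBall k = {α | Valued.v α ≤ WithZero.exp (-1 : ℤ)} := by
  ext α
  rw [mem_unitBall_iff, Set.mem_ofPred_eq, LaurentSeries.valuation_le_iff_coeff_lt_eq_zero]

theorem isOpen_unitBall [Finite k] : IsOpen (unitBall k) := by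
  rw [unitBall_eq_valuation]
  have h1 : (Valued.v : Valuation k⸨X⸩ _) (HahnSeries.single (1 : ℤ) (1 : k)) =
      WithZero.exp (-1 : ℤ) := LaurentSeries.valuation_single_zpow k 1
  have h2 := (Valued.isClopen_closedBall (R := k⸨X⸩)
    (r := Valued.v.restrict (HahnSeries.single (1 : ℤ) (1 : k) : k⸨X⸩)) (by simp)).2
  simp_rw [Valuation.restrict_le_iff, h1] at h2
  exact h2

theorem isCompact_unitBall [Finite k] : IsCompact (unitBall k) := by
  let _ : TopologicalSpace k := ⊥
  have _ : DiscreteTopology k := ⟨rfl⟩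
  let φ : (ℕ → k) → k⸨X⸩ := fun a =>
    HahnSeries.single (1 : ℤ) (1 : k) * HahnSeries.ofPowerSeries ℤ k (PowerSeries.mk a)
  have hφ : ∀ (a : ℕ → k) (i : ℕ), (φ a).coeff ((i : ℤ) + 1) = a i := by
    intro a i
    have := HahnSeries.coeff_single_mul_add (r := (1 : k))
      (x := HahnSeries.ofPowerSeries ℤ k (PowerSeries.mk a)) (a := (i : ℤ)) (b := (1 : ℤ))
    simp only [φ]
    rw [this, one_mul, LaurentSeries.coeff_coe_powerSeries, PowerSeries.coeff_mk]
  have hφ0 : ∀ (a : ℕ → k) (m : ℤ), m < 1 → (φ a).coeff m = 0 := by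
    intro a m hm
    obtain ⟨j, rfl⟩ : ∃ j : ℤ, m = j + 1 := ⟨m - 1, by ring⟩
    simp only [φ]
    rw [HahnSeries.coeff_single_mul_add, one_mul, PowerSeries.coeff_coe, if_pos (by omega)]
  have hcont : Continuous φ := by
    rw [continuous_iff_continuousAt]
    intro a s hs
    rw [Valued.mem_nhds] at hs
    obtain ⟨γ, hγ⟩ := hs
    simp_rw [Valuation.restrict_lt_iff_lt_embedding] at hγ
    set g := MonoidWithZeroHom.ValueGroup₀.embedding γ.1 with hg
    have hg0 : g ≠ 0 := by simp [hg]
    set N : ℤ := -(WithZero.log g - 1) with hN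
    have hNg : WithZero.exp (-N) < g := by
      rw [← WithZero.lt_log_iff_exp_lt hg0, hN]
      simp
    have hopen : {b : ℕ → k | ∀ i ∈ Finset.range N.toNat, b i = a i} ∈ 𝓝 a := by
      refine (Filter.eventually_all_finset _).2 fun i _ => ?_
      have h1 : ∀ᶠ c in 𝓝 (a i), c = a i := (isOpen_discrete {a i}).mem_nhds rfl
      exact (continuous_apply i).continuousAt.eventually h1
    refine Filter.mem_map.2 (Filter.mem_of_superset hopen fun b hb => hγ ?_)
    refine lt_of_le_of_lt ((LaurentSeries.valuation_le_iff_coeff_lt_eq_zero k).2 ?_) hNg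
    intro m hm
    rw [HahnSeries.coeff_sub, sub_eq_zero]
    rcases lt_or_ge m 1 with hm1 | hm1
    · rw [hφ0 _ m hm1, hφ0 _ m hm1]
    · obtain ⟨i, rfl⟩ : ∃ i : ℕ, m = (i : ℤ) + 1 := ⟨(m - 1).toNat, by omega⟩
      rw [hφ, hφ]
      exact hb i (Finset.mem_range.2 (by omega))
  have : unitBall k = Set.range φ := by
    ext α
    rw [mem_unitBall_iff]
    constructor
    · intro h
      refine ⟨fun i => α.coeff ((i : ℤ) + 1), ?_⟩
      ext m
      rcases lt_or_ge m 1 with hm | hm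
      · rw [hφ0 _ m hm, h m hm]
      · obtain ⟨i, rfl⟩ : ∃ i : ℕ, m = (i : ℤ) + 1 := ⟨(m - 1).toNat, by omega⟩
        rw [hφ]
    · rintro ⟨a, rfl⟩
      exact hφ0 a
  rw [this]
  exact isCompact_range hcont

instance : MeasurableSpace k⸨X⸩ := borel _

instance : BorelSpace k⸨X⸩ := ⟨rfl⟩

variable (k) in
/-- The unit ball as a compact set with nonempty interior. -/
def unitBallCompacts [Finite k] : TopologicalSpace.PositiveCompacts k⸨X⸩ where
  carrier := unitBall k
  isCompact' := isCompact_unitBall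
  interior_nonempty' := by
    rw [isOpen_unitBall.interior_eq]
    exact ⟨0, by simp [unitBall, absInf]⟩

variable (k) in
/-- The Haar measure on `k((t⁻¹))` for which the unit ball `𝕋` has measure `1`. -/
def haar [Finite k] : MeasureTheory.Measure k⸨X⸩ :=
  MeasureTheory.Measure.addHaarMeasure (unitBallCompacts k)

/-- The additive character `ψ(∑ aᵢ tⁱ) = e(Tr(a₋₁) / p)` of `k((t⁻¹))`, where `Tr` is the trace from
`k` to its prime field; `ZMod.stdAddChar` is `j ↦ e(j / p)`. -/
def psi (p : ℕ) [NeZero p] [Algebra (ZMod p) k] (α : k⸨X⸩) : ℂ :=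
  ZMod.stdAddChar (Algebra.trace (ZMod p) k (α.coeff 1))

end LocalField

/-! ### Oscillatory integrals -/

section Integrals

variable {k : Type*} [Field k] {n : ℕ}

/-- The value of a polynomial with coefficients in `k[t]` at a point of `k((t⁻¹))ⁿ`. -/
def evalInf (F : MvPolynomial (Fin n) k[X]) (x : Fin n → k⸨X⸩) : k⸨X⸩ :=
  MvPolynomial.eval₂ (polyEmb k) x F

/-- `J_{F,ω}(γ, w) = ∫ ω(x) ψ(γ F(x) + w · x) dx` over `k((t⁻¹))ⁿ`. -/
def oscInt [Finite k] (p : ℕ) [NeZero p] [Algebra (ZMod p) k]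
    (F : MvPolynomial (Fin n) k[X]) (ω : (Fin n → k⸨X⸩) → ℝ)
    (γ : k⸨X⸩) (w : Fin n → k⸨X⸩) : ℂ :=
  ∫ x : Fin n → k⸨X⸩, (ω x : ℂ) * psi p (γ * evalInf F x + ∑ i, w i * x i)
    ∂(MeasureTheory.Measure.pi fun _ : Fin n => haar k)

/-- `J^Γ_{F,ω}(w)`, the integral of `J_{F,ω}(γ, w)` over `|γ| < q ^ Γ`. -/
def avgOscInt [Finite k] (p : ℕ) [NeZero p] [Algebra (ZMod p) k]
    (F : MvPolynomial (Fin n) k[X]) (ω : (Fin n → k⸨X⸩) → ℝ)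
    (Γ : ℤ) (w : Fin n → k⸨X⸩) : ℂ :=
  ∫ γ in {γ : k⸨X⸩ | absInf γ < (Nat.card k : ℝ) ^ Γ}, oscInt p F ω γ w ∂(haar k)

/-- The Hessian matrix of `F` at a point of `k((t⁻¹))ⁿ`. -/
def hessianInf (F : MvPolynomial (Fin n) k[X]) (x : Fin n → k⸨X⸩) :
    Matrix (Fin n) (Fin n) k⸨X⸩ :=
  Matrix.of fun i j => evalInf (MvPolynomial.pderiv i (MvPolynomial.pderiv j F)) x

/-- `ω` is the indicator function of an open ball of radius `q ^ (-L)` around a point `x₀` with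
`|x₀| ≤ 1`, and the Hessian of `F` is nonsingular on the support of `ω` (the ball is open and
closed, so it is not necessary to take a closure). -/
structure IsWeight (F : MvPolynomial (Fin n) k[X]) (L : ℕ) (ω : (Fin n → k⸨X⸩) → ℝ) : Prop where
  hessian_det_ne_zero : ∀ x ∈ Function.support ω, (hessianInf F x).det ≠ 0
  eq_indicator : ∃ x₀ : Fin n → k⸨X⸩, supNorm x₀ ≤ 1 ∧
    ω = Set.indicator {x | supNorm (x - x₀) < (Nat.card k : ℝ) ^ (-(L : ℤ))} 1

end Integrals

/-! ### Non-singular forms and dual forms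

Geometric points have coordinates in an algebraic closure of `K = k(t)`. -/

section Dual

variable {k : Type*} [Field k] {n : ℕ}

/-- An algebraic closure of `k(t)`. -/
abbrev KBar (k : Type*) [Field k] : Type _ := AlgebraicClosure (RatFunc k)

/-- The gradient of `F` at a geometric point. -/
def gradBar (F : MvPolynomial (Fin n) k[X]) (x : Fin n → KBar k) : Fin n → KBar k :=
  fun i => MvPolynomial.aeval x (MvPolynomial.pderiv i F)

/-- The projective hypersurface `F = 0` is non-singular over `k(t)`. -/
def IsNonsingular (F : MvPolynomial (Fin n) k[X]) : Prop :=
  ∀ x : Fin n → KBar k, MvPolynomial.aeval x F = 0 → gradBar F x = 0 → x = 0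

/-- `D` is a dual form of `F`: a form over `k[t]` which is primitive and which generates the ideal
of the dual variety, i.e. of the closure of the image of the hypersurface `F = 0` under the Gauss
map `x ↦ ∇F(x)`. A polynomial vanishes on this closure if and only if it vanishes on the image.
These conditions determine `D` up to a unit of `k[t]`. -/
structure IsDualForm (F D : MvPolynomial (Fin n) k[X]) : Prop where
  isHomogeneous : D.IsHomogeneous D.totalDegree
  primitive : ∀ c : k[X], MvPolynomial.C c ∣ D → IsUnit c
  generates : ∀ G : MvPolynomial (Fin n) (KBar k),
    (∀ x : Fin n → KBar k, x ≠ 0 → MvPolynomial.aeval x F = 0 →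
      MvPolynomial.eval (gradBar F x) G = 0) ↔
    MvPolynomial.map (algebraMap k[X] (KBar k)) D ∣ G

end Dual

end

end FFCubic

/-!
The proof is a stationary phase argument in which all error terms are made to vanish exactly by
averaging over measure preserving substitutions. Write `φ(x) = γ F(x) + w · x` for the phase.

*Scaling.* Since `F` is a cubic form, replacing `(γ, x)` by `(u⁻² γ, u x)` replaces `φ` by `u φ`. For
`|u - 1| < 1` this substitution preserves the measure, the range of `γ` and the ball on which the
weight is supported. Averaging over `u` therefore leaves only the points with `|φ(x)| ≤ 1`.

*Translation.* For fixed `γ`, translating `x` by `y` with `|y|` a small multiple of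
`min(1, |γ|^(-1/2))` changes `φ` by `∇φ(x) · y` up to an error on which the character is trivial.
Averaging over `y` leaves only the points with `|∇φ(x)| ≪ max(1, |γ|^(1/2))`. Thus, if
`J^Γ(w) ≠ 0`, there are `γ` and `x` in the ball at which both bounds hold
(`exists_approx_critical_point`).

*Newton step.* The Hessian determinant is bounded away from zero on the ball, by compactness. If
`|γ| ≥ 1`, one Newton step leads from `x` to a point `z` with `∇φ(z) = O(1)`, that is
`w = -γ ∇F(z) + O(1)`, and still `φ(z) = O(1)`. By Euler's identity `φ(z) = -2 γ F(z) + O(1)`, so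
`γ F(z) = O(1)` (`exists_newton_step`). Euler's identity for `∇F` also gives `|γ| ≪ 1 + |w|`
(`exists_scale_le`).

*Dual form.* `F` is squarefree because it is non-singular in at least two variables, so by the
Nullstellensatz `D ∘ ∇F` is divisible by `F` (`exists_eval_compGrad_eq`). Hence
`D(∇F(z)) = O(|F(z)|) = O(1 / |γ|)`, and `D(w) = (-γ)^d D(∇F(z) + O(1 / γ)) = O(|γ|^(d - 1))`
(`exists_eval_dual_le`). If `|γ| ≤ 1`, then `w` itself is bounded. In at most one variable the dual
form is constant and the bound is trivial.
-/

namespace FFCubic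

open MvPolynomial

/-! ### Homogeneous polynomials and the dual form -/

theorem eval_mul_of_isHomogeneous {R σ : Type*} [CommRing R] [Fintype σ] {P : MvPolynomial σ R}
    {d : ℕ} (hP : P.IsHomogeneous d) (c : R) (x : σ → R) :
    eval (fun i => c * x i) P = c ^ d * eval x P := by
  rw [eval_eq', eval_eq', Finset.mul_sum]
  refine Finset.sum_congr rfl fun m hm => ?_
  have hd : ∑ i, m i = d := by
    rw [← hP (mem_support_iff.1 hm), Finsupp.weight_apply, Finsupp.sum_fintype _ _ (by simp)]
    simp
  simp_rw [mul_pow, Finset.prod_mul_distrib, Finset.prod_pow_eq_pow_sum, hd]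
  ring

theorem sum_mul_eval_pderiv {R σ : Type*} [CommRing R] [Fintype σ] {P : MvPolynomial σ R}
    {d : ℕ} (hP : P.IsHomogeneous d) (x : σ → R) :
    ∑ i, x i * eval x (pderiv i P) = d * eval x P := by
  simpa using congrArg (eval x) hP.sum_X_mul_pderiv

section Nullstellensatz

variable {K σ : Type*} [Field K] [IsAlgClosed K] [Finite σ]

/-- A square factor `P` of `F` would vanish at the origin at most, since its zeros are singular
points of `F = 0`. By the Nullstellensatz `P` then divides powers of two different variables. -/
theorem squarefree_of_nonsingular [Nontrivial σ] {F : MvPolynomial σ K}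
    (hF : ∀ x : σ → K, eval x F = 0 → (∀ i, eval x (pderiv i F) = 0) → x = 0) :
    Squarefree F := by
  rintro P ⟨R, rfl⟩
  have hzero : ∀ x : σ → K, eval x P = 0 → x = 0 := by
    intro x hx
    apply hF x
    · simp [hx]
    · intro i
      simp [Derivation.leibniz, hx]
  have hdvd : ∀ i : σ, ∃ m : ℕ, P ∣ X i ^ m := by
    intro i
    have h1 : (X i : MvPolynomial σ K) ∈ vanishingIdeal K (zeroLocus K (Ideal.span {P})) := by
      rw [mem_vanishingIdeal_iff]
      intro x hx
      rw [zeroLocus_span] at hx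
      have hx0 := hzero x (by simpa [aeval_eq_eval] using hx)
      simp [hx0]
    rw [vanishingIdeal_zeroLocus_eq_radical] at h1
    obtain ⟨m, hm⟩ := h1
    exact ⟨m, Ideal.mem_span_singleton.1 hm⟩
  obtain ⟨i, j, hij⟩ := exists_pair_ne σ
  obtain ⟨a, ha⟩ := hdvd i
  obtain ⟨b, hb⟩ := hdvd j
  have hprime : IsRelPrime (X i : MvPolynomial σ K) (X j) := by
    rw [(X_prime (i := i)).irreducible.isRelPrime_iff_not_dvd, X_dvd_X]
    simp [hij]
  exact hprime.pow ha hb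

theorem dvd_of_squarefree {F G : MvPolynomial σ K} (hF : Squarefree F)
    (h : ∀ x : σ → K, eval x F = 0 → eval x G = 0) : F ∣ G := by
  have h1 : G ∈ vanishingIdeal K (zeroLocus K (Ideal.span {F})) := by
    rw [mem_vanishingIdeal_iff]
    intro x hx
    rw [zeroLocus_span] at hx
    simpa [aeval_eq_eval] using h x (by simpa [aeval_eq_eval] using hx)
  rw [vanishingIdeal_zeroLocus_eq_radical] at h1
  obtain ⟨m, hm⟩ := h1
  exact hF.isRadical m G (Ideal.mem_span_singleton.1 hm)

end Nullstellensatz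

/-- Divisibility of polynomials descends along an extension of fields: apply a `K`-linear
retraction `M → K` to the coefficients of the quotient. -/
theorem dvd_of_map_dvd_map {K M σ : Type*} [Field K] [Field M] [Algebra K M]
    {F G : MvPolynomial σ K} (h : map (algebraMap K M) F ∣ map (algebraMap K M) G) : F ∣ G := by
  obtain ⟨r, hr⟩ := LinearMap.exists_leftInverse_of_injective (Algebra.linearMap K M)
    (LinearMap.ker_eq_bot.2 (algebraMap K M).injective)
  have hr1 : ∀ a : K, r (algebraMap K M a) = a := fun a => LinearMap.congr_fun hr a
  obtain ⟨Q, hQ⟩ := h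
  classical
  refine ⟨∑ m ∈ Q.support, monomial m (r (Q.coeff m)), ?_⟩
  have hcoeff : ∀ m, coeff m (∑ m ∈ Q.support, monomial m (r (Q.coeff m))) = r (Q.coeff m) := by
    intro m
    simp only [coeff_sum, coeff_monomial, Finset.sum_ite_eq']
    split_ifs with hm
    · rfl
    · rw [notMem_support_iff.1 hm, map_zero]
  ext m
  have h1 := congrArg (fun P => r (coeff m P)) hQ
  simp only [coeff_map, hr1] at h1
  rw [h1, coeff_mul, coeff_mul, map_sum]
  refine Finset.sum_congr rfl fun p _ => ?_
  rw [hcoeff, coeff_map, ← Algebra.smul_def, map_smul, smul_eq_mul]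

section DualForm

variable {k : Type*} [Field k] {n : ℕ} {F D : MvPolynomial (Fin n) k[X]}

theorem algebraMap_KBar_injective : Function.Injective (algebraMap k[X] (KBar k)) := by
  rw [IsScalarTower.algebraMap_eq k[X] (RatFunc k) (KBar k), RingHom.coe_comp]
  exact (algebraMap (RatFunc k) (KBar k)).injective.comp (IsFractionRing.injective k[X] (RatFunc k))

/-- If the hypersurface `F = 0` has no geometric points at all, its dual form is constant; this is
the case when there is at most one variable. -/
theorem IsDualForm.totalDegree_eq_zero (hD : IsDualForm F D)
    (h : ∀ x : Fin n → KBar k, aeval x F = 0 → x = 0) : D.totalDegree = 0 := by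
  have h1 := (hD.generates 1).1 fun x hx hF => absurd (h x hF) hx
  have h2 := isUnit_of_dvd_one h1
  rw [MvPolynomial.isUnit_iff_totalDegree_of_isReduced] at h2
  rw [← h2.2]
  simp only [totalDegree, support_map_of_injective _ algebraMap_KBar_injective]

theorem nontrivial_of_totalDegree_ne_zero (hD : IsDualForm F D) (hF : F.IsHomogeneous 3)
    (hns : IsNonsingular F) (hd : D.totalDegree ≠ 0) : Nontrivial (Fin n) := by
  rw [Fin.nontrivial_iff_two_le]
  by_contra! hn
  refine hd (hD.totalDegree_eq_zero fun x hx => ?_)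
  by_contra hx0
  refine hx0 (hns x hx (funext fun i => ?_))
  have hsub : Subsingleton (Fin n) := by
    rw [Fin.subsingleton_iff_le_one]; omega
  have hE := sum_mul_eval_pderiv (hF.map (algebraMap k[X] (KBar k))) x
  rw [Fintype.sum_subsingleton _ i, pderiv_map, eval_map, eval_map, ← aeval_def, ← aeval_def, hx,
    mul_zero, mul_eq_zero] at hE
  refine hE.resolve_left fun hxi => hx0 (funext fun j => ?_)
  rw [Subsingleton.elim j i, hxi]; rfl

/-- The composite `D ∘ ∇F`. -/
noncomputable def compGrad (F D : MvPolynomial (Fin n) k[X]) : MvPolynomial (Fin n) k[X] :=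
  bind₁ (fun i => pderiv i F) D

theorem eval_map_compGrad {A : Type*} [CommRing A] (φ : k[X] →+* A) (x : Fin n → A) :
    eval x (map φ (compGrad F D)) =
      eval (fun i => eval x (map φ (pderiv i F))) (map φ D) := by
  rw [compGrad, map_bind₁, ← coe_aeval_eq_eval, RingHom.coe_coe, aeval_bind₁]
  rfl

/-- Over the algebraic closure, `D ∘ ∇F` vanishes on the zeros of `F`, and `F` is squarefree. -/
theorem map_dvd_map_compGrad (hD : IsDualForm F D) (hF : F.IsHomogeneous 3)
    (hns : IsNonsingular F) (hd : D.totalDegree ≠ 0) :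
    map (algebraMap k[X] (KBar k)) F ∣ map (algebraMap k[X] (KBar k)) (compGrad F D) := by
  have := nontrivial_of_totalDegree_ne_zero hD hF hns hd
  have hev : ∀ (P : MvPolynomial (Fin n) k[X]) (x : Fin n → KBar k),
      eval x (map (algebraMap k[X] (KBar k)) P) = aeval x P := fun P x => by
    rw [eval_map, aeval_def]
  refine dvd_of_squarefree (squarefree_of_nonsingular fun x hx hgrad => ?_) fun x hx => ?_
  · refine hns x (by rwa [hev] at hx) (funext fun i => ?_)
    have := hgrad i
    rwa [pderiv_map, hev] at this
  · rw [hev] at hx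
    rw [eval_map_compGrad, show (fun i => eval x (map (algebraMap k[X] (KBar k)) (pderiv i F))) =
      fun i => aeval x (pderiv i F) from funext fun i => hev _ x]
    by_cases hx0 : x = 0
    · subst hx0
      have hg : (fun i => aeval (0 : Fin n → KBar k) (pderiv i F)) = fun i => 0 * 0 := by
        funext i
        have h2 := eval_mul_of_isHomogeneous ((hF.pderiv (i := i)).map (algebraMap k[X] (KBar k)))
          0 0
        simpa [hev, ← Pi.zero_def] using h2
      rw [hg, eval_mul_of_isHomogeneous (hD.isHomogeneous.map _), zero_pow hd, zero_mul]
    · exact (hD.generates _).2 dvd_rfl x hx0 hx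

/-- The divisibility of `D ∘ ∇F` by `F` holds already over `k(t)`, hence over every field that
contains `k[t]`. -/
theorem exists_eval_compGrad_eq {L : Type*} [Field L] {φ : k[X] →+* L}
    (hφ : Function.Injective φ) (hD : IsDualForm F D) (hF : F.IsHomogeneous 3)
    (hns : IsNonsingular F) (hd : D.totalDegree ≠ 0) :
    ∃ Q : MvPolynomial (Fin n) L, ∀ x : Fin n → L,
      eval (fun i => eval x (map φ (pderiv i F))) (map φ D) = eval x (map φ F) * eval x Q := by
  have h1 : map (algebraMap k[X] (RatFunc k)) F ∣
      map (algebraMap k[X] (RatFunc k)) (compGrad F D) := by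
    apply dvd_of_map_dvd_map (M := KBar k)
    rw [map_map, map_map, ← IsScalarTower.algebraMap_eq]
    exact map_dvd_map_compGrad hD hF hns hd
  obtain ⟨Q, hQ⟩ := h1
  let j : RatFunc k →+* L := IsFractionRing.lift hφ
  have hj : j.comp (algebraMap k[X] (RatFunc k)) = φ :=
    RingHom.ext fun a => IsFractionRing.lift_algebraMap hφ a
  refine ⟨map j Q, fun x => ?_⟩
  have h2 := congrArg (fun P => eval x (map j P)) hQ
  simp only [map_mul, map_map, hj] at h2
  rw [← h2, eval_map_compGrad]

end DualForm

/-! ### Taylor estimates for polynomials over a field with an absolute value -/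

section Estimates

variable {L : Type*} [Field L] (v : AbsoluteValue L ℝ) {σ : Type*}

theorem exists_eval_le (P : MvPolynomial σ L) (R : ℝ) :
    ∃ A : ℝ, 0 ≤ A ∧ ∀ x : σ → L, (∀ i, v (x i) ≤ R) → v (eval x P) ≤ A := by
  induction P using MvPolynomial.induction_on with
  | C a => exact ⟨v a, v.nonneg a, fun x _ => by simp⟩
  | add P Q hP hQ =>
    obtain ⟨A, hA0, hA⟩ := hP
    obtain ⟨B, hB0, hB⟩ := hQ
    refine ⟨A + B, add_nonneg hA0 hB0, fun x hx => ?_⟩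
    rw [map_add]
    exact (v.add_le _ _).trans (add_le_add (hA x hx) (hB x hx))
  | mul_X P j hP =>
    obtain ⟨A, hA0, hA⟩ := hP
    refine ⟨A * |R|, by positivity, fun x hx => ?_⟩
    rw [map_mul, eval_X, v.map_mul]
    exact mul_le_mul (hA x hx) ((hx j).trans (le_abs_self R)) (v.nonneg _) hA0

variable [Fintype σ]

/-- A second order Taylor estimate, uniform on bounded sets. -/
theorem exists_taylor_le (P : MvPolynomial σ L) (R : ℝ) :
    ∃ A : ℝ, 0 ≤ A ∧ ∀ (x y : σ → L) (r : ℝ), (∀ i, v (x i) ≤ R) → (∀ i, v (y i) ≤ r) → 0 ≤ r →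
      r ≤ R → v (eval (x + y) P - eval x P - ∑ i, y i * eval x (pderiv i P)) ≤ A * r ^ 2 := by
  classical
  induction P using MvPolynomial.induction_on with
  | C a =>
    refine ⟨0, le_rfl, fun x y r _ _ _ _ => by simp⟩
  | add P Q hP hQ =>
    obtain ⟨A, hA0, hA⟩ := hP
    obtain ⟨B, hB0, hB⟩ := hQ
    refine ⟨A + B, add_nonneg hA0 hB0, fun x y r hx hy h0 hr => ?_⟩
    have h1 := v.add_le (eval (x + y) P - eval x P - ∑ i, y i * eval x (pderiv i P))
      (eval (x + y) Q - eval x Q - ∑ i, y i * eval x (pderiv i Q))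
    have h2 : eval (x + y) (P + Q) - eval x (P + Q) - ∑ i, y i * eval x (pderiv i (P + Q)) =
        (eval (x + y) P - eval x P - ∑ i, y i * eval x (pderiv i P)) +
        (eval (x + y) Q - eval x Q - ∑ i, y i * eval x (pderiv i Q)) := by
      simp only [map_add, mul_add, Finset.sum_add_distrib]
      ring
    rw [h2, add_mul]
    exact h1.trans (add_le_add (hA x y r hx hy h0 hr) (hB x y r hx hy h0 hr))
  | mul_X P j hP =>
    obtain ⟨A, hA0, hA⟩ := hP
    choose B hB0 hB using fun i => exists_eval_le v (pderiv i P) R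
    refine ⟨A * (2 * |R|) + ∑ i, B i, ?_, fun x y r hx hy h0 hr => ?_⟩
    · have := Finset.sum_nonneg fun i (_ : i ∈ Finset.univ) => hB0 i
      positivity
    have h1 : eval (x + y) (P * X j) - eval x (P * X j) -
        ∑ i, y i * eval x (pderiv i (P * X j)) =
        (eval (x + y) P - eval x P - ∑ i, y i * eval x (pderiv i P)) * (x j + y j) +
          (∑ i, y i * eval x (pderiv i P)) * y j := by
      have h2 : ∑ i, y i * eval x (pderiv i (P * X j)) =
          (∑ i, y i * eval x (pderiv i P)) * x j + eval x P * y j := by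
        have h3 : ∀ i, y i * eval x (pderiv i (P * X j)) =
            y i * eval x (pderiv i P) * x j + if i = j then eval x P * y j else 0 := by
          intro i
          rw [Derivation.leibniz, pderiv_X]
          by_cases hij : i = j
          · subst hij
            simp
            ring
          · simp [hij, Ne.symm hij]
            ring
        simp_rw [h3, Finset.sum_add_distrib, Finset.sum_mul]
        simp
      rw [h2]
      simp
      ring
    have h4 : v (x j + y j) ≤ 2 * |R| :=
      (v.add_le _ _).trans (by linarith [hx j, hy j, le_abs_self R])
    have h5 : v ((∑ i, y i * eval x (pderiv i P)) * y j) ≤ (∑ i, B i) * r ^ 2 := by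
      rw [v.map_mul, sq, ← mul_assoc]
      refine mul_le_mul ?_ (hy j) (v.nonneg _)
        (mul_nonneg (Finset.sum_nonneg fun i _ => hB0 i) h0)
      rw [Finset.sum_mul]
      refine (v.sum_le _ _).trans (Finset.sum_le_sum fun i _ => ?_)
      rw [v.map_mul, mul_comm]
      exact mul_le_mul (hB i x hx) (hy i) (v.nonneg _) (hB0 i)
    have h6 : v ((eval (x + y) P - eval x P - ∑ i, y i * eval x (pderiv i P)) * (x j + y j)) ≤
        A * r ^ 2 * (2 * |R|) := by
      rw [v.map_mul]
      exact mul_le_mul (hA x y r hx hy h0 hr) h4 (v.nonneg _) (by positivity)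
    rw [h1]
    refine (v.add_le _ _).trans ((add_le_add h6 h5).trans (le_of_eq ?_))
    ring

theorem exists_lipschitz_le (P : MvPolynomial σ L) (R : ℝ) :
    ∃ A : ℝ, 0 ≤ A ∧ ∀ (x y : σ → L) (r : ℝ), (∀ i, v (x i) ≤ R) → (∀ i, v (y i) ≤ r) → 0 ≤ r →
      r ≤ R → v (eval (x + y) P - eval x P) ≤ A * r := by
  obtain ⟨A, hA0, hA⟩ := exists_taylor_le v P R
  choose B hB0 hB using fun i => exists_eval_le v (pderiv i P) R
  have hsum := Finset.sum_nonneg fun i (_ : i ∈ Finset.univ) => hB0 i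
  refine ⟨A * |R| + ∑ i, B i, by positivity, fun x y r hx hy h0 hr => ?_⟩
  have h1 := hA x y r hx hy h0 hr
  have h2 : v (∑ i, y i * eval x (pderiv i P)) ≤ (∑ i, B i) * r := by
    rw [Finset.sum_mul]
    refine (v.sum_le _ _).trans (Finset.sum_le_sum fun i _ => ?_)
    rw [v.map_mul, mul_comm]
    exact mul_le_mul (hB i x hx) (hy i) (v.nonneg _) (hB0 i)
  have h3 := v.add_le (eval (x + y) P - eval x P - ∑ i, y i * eval x (pderiv i P))
    (∑ i, y i * eval x (pderiv i P))
  rw [sub_add_cancel] at h3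
  have h4 : A * r ^ 2 ≤ A * |R| * r := by
    rw [mul_assoc, sq]
    gcongr
    exact hr.trans (le_abs_self R)
  linarith

end Estimates

/-! ### From an approximate critical point to the bound for the dual form -/

section Core

variable {L : Type*} [Field L] (v : AbsoluteValue L ℝ) {σ : Type*} [Fintype σ] [DecidableEq σ]

/-- The Hessian matrix of a polynomial, with polynomial entries. -/
noncomputable def polyHessian (F : MvPolynomial σ L) : Matrix σ σ (MvPolynomial σ L) :=
  Matrix.of fun i j => pderiv i (pderiv j F)

/-- The value of the Hessian matrix at a point. -/
noncomputable def hessianAt (F : MvPolynomial σ L) (x : σ → L) : Matrix σ σ L :=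
  Matrix.of fun i j => eval x (pderiv i (pderiv j F))

theorem hessianAt_eq_map (F : MvPolynomial σ L) (x : σ → L) :
    hessianAt F x = (eval x).mapMatrix (polyHessian F) := rfl

theorem det_hessianAt (F : MvPolynomial σ L) (x : σ → L) :
    (hessianAt F x).det = eval x (polyHessian F).det := by
  rw [hessianAt_eq_map, RingHom.map_det]

omit [DecidableEq σ] in
theorem vecMul_hessianAt {F : MvPolynomial σ L} (hF : F.IsHomogeneous 3) (x : σ → L) :
    Matrix.vecMul x (hessianAt F x) = fun j => 2 * eval x (pderiv j F) := by
  funext j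
  have := sum_mul_eval_pderiv (hF.pderiv (i := j)) x
  simpa [Matrix.vecMul, dotProduct, hessianAt] using this

/-- A point of the unit ball at which the Hessian determinant is bounded below is not close to
the origin, where the Hessian vanishes. -/
theorem exists_le_of_le_det [Nonempty σ] {F : MvPolynomial σ L} (hF : F.IsHomogeneous 3) {c : ℝ}
    (hc : 0 < c) : ∃ c₁ : ℝ, 0 < c₁ ∧ ∀ x : σ → L, c ≤ v (hessianAt F x).det →
      ∃ i, c₁ ≤ v (x i) := by
  obtain ⟨A, hA0, hA⟩ := exists_lipschitz_le v (polyHessian F).det 1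
  refine ⟨min 1 (c / (A + 1)), by positivity, fun x hx => ?_⟩
  by_contra! hlt
  have h1 := hA 0 x (min 1 (c / (A + 1))) (fun i => by simp) (fun i => (hlt i).le)
    (by positivity) (min_le_left _ _)
  have h0 : eval (0 : σ → L) (polyHessian F).det = 0 := by
    rw [← det_hessianAt]
    have : hessianAt F 0 = 0 := by
      ext i j
      have := eval_mul_of_isHomogeneous ((hF.pderiv (i := j)).pderiv (i := i)) 0 0
      simpa [hessianAt, ← Pi.zero_def] using this
    rw [this, Matrix.det_zero]
  rw [zero_add, h0, sub_zero, ← det_hessianAt] at h1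
  have h2 : A * min 1 (c / (A + 1)) ≤ A * (c / (A + 1)) := by
    gcongr
    exact min_le_right _ _
  have h3 : A * (c / (A + 1)) < c := by
    rw [mul_div_assoc', div_lt_iff₀ (by positivity)]
    nlinarith
  linarith

/-- Cofactors of the Hessian matrix are bounded on the unit ball. -/
theorem exists_vecMul_adjugate_le (F : MvPolynomial σ L) :
    ∃ A : ℝ, 0 ≤ A ∧ ∀ (x e : σ → L) (r : ℝ), (∀ i, v (x i) ≤ 1) → (∀ i, v (e i) ≤ r) →
      ∀ j, v (Matrix.vecMul e (hessianAt F x).adjugate j) ≤ A * r := by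
  choose B hB0 hB using fun i j => exists_eval_le v ((polyHessian F).adjugate i j) 1
  have hsum : ∀ i, ∑ j, B i j ≥ 0 := fun i => Finset.sum_nonneg fun j _ => hB0 i j
  refine ⟨∑ i, ∑ j, B i j, Finset.sum_nonneg fun i _ => hsum i, fun x e r hx he j => ?_⟩
  have hadj : ∀ i, v ((hessianAt F x).adjugate i j) ≤ ∑ j, B i j := by
    intro i
    rw [hessianAt_eq_map, ← RingHom.map_adjugate]
    exact (hB i j x hx).trans (Finset.single_le_sum (fun j _ => hB0 i j) (Finset.mem_univ j))
  rw [Matrix.vecMul, dotProduct, Finset.sum_mul]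
  refine (v.sum_le _ _).trans (Finset.sum_le_sum fun i _ => ?_)
  rw [v.map_mul, mul_comm]
  exact mul_le_mul (hadj i) (he i) (v.nonneg _) (hsum i)

/-- An approximate critical point of `γ F + w · x` forces `|γ|` to be at most of the size of
`|w|`. -/
theorem exists_scale_le [Nonempty σ] {F : MvPolynomial σ L} (hF : F.IsHomogeneous 3) {c M : ℝ}
    (hc : 0 < c) (hM : 1 ≤ M) : ∃ A : ℝ, 0 ≤ A ∧ ∀ (γ : L) (w x : σ → L) (r W : ℝ),
      (∀ i, v (x i) ≤ 1) → c ≤ v (hessianAt F x).det → v γ ≤ r ^ 2 → r ^ 2 ≤ M * v γ →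
      (∀ i, v (γ * eval x (pderiv i F) + w i) ≤ M * r) → (∀ i, v (w i) ≤ W) → 0 ≤ W →
      v γ ≤ A * (1 + W) := by
  obtain ⟨c₁, hc₁, hlow⟩ := exists_le_of_le_det v hF hc
  obtain ⟨B, hB0, hB⟩ := exists_vecMul_adjugate_le v F
  set K := M * (v 2 * (B * M) / (c₁ * c)) with hK
  have hv2 := v.nonneg 2
  have hK0 : 0 ≤ K := by positivity
  refine ⟨K ^ 2 + 2 * K, by positivity, fun γ w x r W hx hdet hr hr' he hw hW => ?_⟩
  obtain ⟨j, hj⟩ := hlow x hdet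
  have hew : ∀ i, v (γ * eval x (pderiv i F)) ≤ M * r + W := by
    intro i
    have h1 := v.sub_le_add (γ * eval x (pderiv i F) + w i) (w i)
    rw [add_sub_cancel_right] at h1
    linarith [he i, hw i]
  have h1 : γ * (x j * (hessianAt F x).det) =
      2 * Matrix.vecMul (fun i => γ * eval x (pderiv i F)) (hessianAt F x).adjugate j := by
    have h2 := congrArg (fun u => Matrix.vecMul u (hessianAt F x).adjugate j)
      (vecMul_hessianAt hF x)
    simp only [Matrix.vecMul_vecMul, Matrix.mul_adjugate, Matrix.vecMul_smul, Matrix.vecMul_one,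
      Pi.smul_apply, smul_eq_mul] at h2
    rw [mul_comm (x j), h2]
    simp only [Matrix.vecMul, dotProduct, Finset.mul_sum]
    exact Finset.sum_congr rfl fun i _ => by ring
  have h3 : v γ * (c₁ * c) ≤ v 2 * (B * (M * r + W)) := by
    have h4 := congrArg v h1
    simp only [v.map_mul] at h4
    calc v γ * (c₁ * c) ≤ v γ * (v (x j) * v (hessianAt F x).det) := by
          gcongr
      _ = _ := h4
      _ ≤ _ := by
          gcongr
          exact hB x _ _ hx hew j
  have hMr : 0 ≤ M * r := (v.nonneg _).trans (he j)
  have hr0 : 0 ≤ r := by nlinarith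
  have h5 : r ^ 2 ≤ K * (r + W) := by
    refine hr'.trans ?_
    rw [hK, mul_assoc]
    gcongr
    rw [div_mul_eq_mul_div, le_div_iff₀ (by positivity)]
    refine h3.trans ?_
    rw [mul_assoc (v 2), mul_assoc B]
    gcongr
    nlinarith
  nlinarith [sq_nonneg (r - K), mul_nonneg (sq_nonneg K) hW]

/-- One Newton step, starting from an approximate critical point of `φ = γ F + w · x` at which
`φ` is bounded, leads to a point where `∇φ` is bounded; Euler's identity then bounds `γ F` there. -/
theorem exists_newton_step [Nonempty σ] {F : MvPolynomial σ L} (hF : F.IsHomogeneous 3)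
    (h2 : (2 : L) ≠ 0) {c M : ℝ} (hc : 0 < c) (hM : 1 ≤ M) :
    ∃ E : ℝ, 0 ≤ E ∧ ∀ (γ : L) (w x : σ → L) (r : ℝ),
      (∀ i, v (x i) ≤ 1) → c ≤ v (hessianAt F x).det → 1 ≤ r → v γ ≤ r ^ 2 → r ^ 2 ≤ M * v γ →
      (∀ i, v (γ * eval x (pderiv i F) + w i) ≤ M * r) →
      v (γ * eval x F + ∑ i, w i * x i) ≤ 1 →
      ∃ z : σ → L, (∀ i, v (z i) ≤ E) ∧ (∀ i, v (γ * eval z (pderiv i F) + w i) ≤ E) ∧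
        v (γ * eval z F) ≤ E := by
  obtain ⟨B, hB0, hB⟩ := exists_vecMul_adjugate_le v F
  -- The Newton step has size at most `Y / r`.
  set Y := B * M * M / c with hY
  have hY0 : 0 ≤ Y := by positivity
  obtain ⟨T, hT0, hT⟩ := exists_taylor_le v F (1 + Y)
  choose S hS0 hS using fun i => exists_taylor_le v (pderiv i F) (1 + Y)
  have hSsum : 0 ≤ ∑ i, S i := Finset.sum_nonneg fun i _ => hS0 i
  set E₁ := (∑ i, S i) * Y ^ 2 with hE₁
  have hE₁0 : 0 ≤ E₁ := by positivity
  set N : ℝ := (Fintype.card σ : ℝ) with hN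
  have hN0 : 0 ≤ N := by positivity
  set E₂ := (1 + N * (Y * M) + T * Y ^ 2 + N * (E₁ * (1 + Y))) / v 2 with hE₂
  have hv2 : 0 < v 2 := v.pos h2
  have hE₂0 : 0 ≤ E₂ := by positivity
  refine ⟨1 + Y + E₁ + E₂, by positivity, fun γ w x r hx hdet hr hγ hγ' he hφ => ?_⟩
  have hγ0 : 0 < v γ := by nlinarith
  have hγne : γ ≠ 0 := v.pos_iff.1 hγ0
  have hdet0 : (hessianAt F x).det ≠ 0 := v.pos_iff.1 (hc.trans_le hdet)
  set e : σ → L := fun i => γ * eval x (pderiv i F) + w i with hedef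
  set y : σ → L := (-(γ * (hessianAt F x).det)⁻¹) •
    Matrix.vecMul e (hessianAt F x).adjugate with hy
  have hyH : ∀ j, γ * Matrix.vecMul y (hessianAt F x) j = -e j := by
    intro j
    rw [hy, Matrix.smul_vecMul, Matrix.vecMul_vecMul, Matrix.adjugate_mul, Matrix.vecMul_smul,
      Matrix.vecMul_one]
    simp only [Pi.smul_apply, smul_eq_mul]
    field_simp
  have hyr : ∀ i, v (y i) ≤ Y / r := by
    intro i
    have h1 := hB x e (M * r) hx he i
    rw [hy, Pi.smul_apply, smul_eq_mul, v.map_mul, v.map_neg, map_inv₀, v.map_mul,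
      inv_mul_le_iff₀ (mul_pos hγ0 (hc.trans_le hdet))]
    refine h1.trans ?_
    rw [hY]
    have h3 : B * (M * r) * (c * r) ≤ (M * v γ) * c * (B * M) := by
      calc B * (M * r) * (c * r) = r ^ 2 * c * (B * M) := by ring
        _ ≤ _ := by gcongr
    calc B * (M * r) = B * (M * r) * (c * r) / (c * r) := by field_simp
      _ ≤ (M * v γ) * c * (B * M) / (c * r) := by gcongr
      _ = v γ * c * (B * M * M / c / r) := by field_simp
      _ ≤ _ := by gcongr
  have hYr0 : 0 ≤ Y / r := by positivity
  have hYr : Y / r ≤ Y := div_le_self hY0 hr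
  have hYr1 : Y / r ≤ 1 + Y := hYr.trans (by linarith)
  have hx1 : ∀ i, v (x i) ≤ 1 + Y := fun i => (hx i).trans (by linarith)
  have hz : ∀ i, v ((x + y) i) ≤ 1 + Y := fun i =>
    (v.add_le _ _).trans (add_le_add (hx i) ((hyr i).trans hYr))
  have hγY : v γ * (Y / r) ^ 2 ≤ Y ^ 2 := by
    rw [div_pow, mul_div_assoc', div_le_iff₀ (by positivity), mul_comm]
    gcongr
  have hgrad : ∀ i, v (γ * eval (x + y) (pderiv i F) + w i) ≤ E₁ := by
    intro i
    have h1 := hS i x y (Y / r) hx1 hyr hYr0 hYr1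
    have h3 : γ * eval (x + y) (pderiv i F) + w i = γ * (eval (x + y) (pderiv i F) -
        eval x (pderiv i F) - ∑ j, y j * eval x (pderiv j (pderiv i F))) := by
      have h4 := hyH i
      simp only [Matrix.vecMul, dotProduct, hessianAt, Matrix.of_apply, hedef] at h4
      linear_combination h4
    rw [h3, v.map_mul]
    calc v γ * _ ≤ v γ * (S i * (Y / r) ^ 2) := by gcongr
      _ = S i * (v γ * (Y / r) ^ 2) := by ring
      _ ≤ (∑ i, S i) * Y ^ 2 := by
        gcongr
        exact Finset.single_le_sum (f := S) (fun j _ => hS0 j) (Finset.mem_univ i)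
  have hsum : ∀ (a b : σ → L) (s t : ℝ), (∀ i, v (a i) ≤ s) → (∀ i, v (b i) ≤ t) →
      v (∑ i, a i * b i) ≤ N * (s * t) := by
    intro a b s t ha hb
    refine (v.sum_le _ _).trans ?_
    rw [hN, ← nsmul_eq_mul, Fintype.card, ← Finset.sum_const]
    refine Finset.sum_le_sum fun i _ => ?_
    rw [v.map_mul]
    exact mul_le_mul (ha i) (hb i) (v.nonneg _) ((v.nonneg _).trans (ha i))
  refine ⟨x + y, fun i => (hz i).trans (by linarith), fun i => (hgrad i).trans (by linarith), ?_⟩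
  have hφz : v (γ * eval (x + y) F + ∑ i, w i * (x + y) i) ≤
      1 + N * (Y * M) + T * Y ^ 2 := by
    have h1 := hT x y (Y / r) hx1 hyr hYr0 hYr1
    have h3 : γ * eval (x + y) F + ∑ i, w i * (x + y) i =
        (γ * eval x F + ∑ i, w i * x i) + ∑ i, y i * e i +
          γ * (eval (x + y) F - eval x F - ∑ i, y i * eval x (pderiv i F)) := by
      simp only [hedef, Pi.add_apply, mul_add, Finset.sum_add_distrib, mul_sub, Finset.mul_sum]
      have h4 : ∑ i, y i * (γ * eval x (pderiv i F)) = ∑ i, γ * (y i * eval x (pderiv i F)) :=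
        Finset.sum_congr rfl fun i _ => by ring
      have h5 : ∑ i, w i * y i = ∑ i, y i * w i := Finset.sum_congr rfl fun i _ => by ring
      rw [h4, h5]
      ring
    rw [h3]
    refine (v.add_le _ _).trans (add_le_add ((v.add_le _ _).trans (add_le_add hφ ?_)) ?_)
    · refine (hsum y e _ _ hyr he).trans (le_of_eq ?_)
      field_simp
    · rw [v.map_mul]
      calc v γ * _ ≤ v γ * (T * (Y / r) ^ 2) := by gcongr
        _ = T * (v γ * (Y / r) ^ 2) := by ring
        _ ≤ _ := by gcongr
  have hEuler : 2 * (γ * eval (x + y) F) =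
      ∑ i, (γ * eval (x + y) (pderiv i F) + w i) * (x + y) i -
        (γ * eval (x + y) F + ∑ i, w i * (x + y) i) := by
    have h1 := sum_mul_eval_pderiv hF (x + y)
    have h3 : ∑ i, (γ * eval (x + y) (pderiv i F) + w i) * (x + y) i =
        γ * ∑ i, (x + y) i * eval (x + y) (pderiv i F) + ∑ i, w i * (x + y) i := by
      rw [Finset.mul_sum, ← Finset.sum_add_distrib]
      exact Finset.sum_congr rfl fun i _ => by ring
    rw [h3, h1]
    push_cast
    ring
  have h1 : v 2 * v (γ * eval (x + y) F) ≤ E₂ * v 2 := by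
    rw [← v.map_mul, hEuler, hE₂, div_mul_cancel₀ _ hv2.ne']
    have h3 := v.sub_le_add (∑ i, (γ * eval (x + y) (pderiv i F) + w i) * (x + y) i)
      (γ * eval (x + y) F + ∑ i, w i * (x + y) i)
    have h4 := hsum _ _ _ _ hgrad hz
    linarith
  have h3 : v (γ * eval (x + y) F) ≤ E₂ := by nlinarith
  linarith

omit [DecidableEq σ] in
/-- If `w + γ ∇F(z)` and `γ F(z)` are bounded, then `D(w)` is smaller by a factor `|γ|` than
expected, provided that `D ∘ ∇F` is divisible by `F`. -/
theorem exists_eval_dual_le {F D Q : MvPolynomial σ L} {d : ℕ} (hD : D.IsHomogeneous (d + 1))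
    (hQ : ∀ x : σ → L, eval (fun i => eval x (pderiv i F)) D = eval x F * eval x Q) {E : ℝ}
    (hE : 0 ≤ E) : ∃ A : ℝ, 0 ≤ A ∧ ∀ (γ : L) (w z : σ → L), 1 ≤ v γ → (∀ i, v (z i) ≤ E) →
      (∀ i, v (γ * eval z (pderiv i F) + w i) ≤ E) → v (γ * eval z F) ≤ E →
      v (eval w D) ≤ A * v γ ^ d := by
  choose G hG0 hG using fun i => exists_eval_le v (pderiv i F) E
  have hGsum : 0 ≤ ∑ i, G i := Finset.sum_nonneg fun i _ => hG0 i
  obtain ⟨B, hB0, hB⟩ := exists_eval_le v Q E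
  obtain ⟨A, hA0, hA⟩ := exists_lipschitz_le v D (∑ i, G i + E)
  refine ⟨A * E + E * B, by positivity, fun γ w z hγ hz hgrad hF => ?_⟩
  have hγ0 : 0 < v γ := by linarith
  have hγne : γ ≠ 0 := v.pos_iff.1 hγ0
  set g : σ → L := fun i => eval z (pderiv i F) with hg
  set u : σ → L := fun i => -(γ⁻¹ * (γ * g i + w i)) with hu
  have hw : w = fun i => -γ * (g + u) i := by
    funext i
    simp only [hu, Pi.add_apply]
    field_simp
    ring
  have hur : ∀ i, v (u i) ≤ E / v γ := by
    intro i
    rw [hu, v.map_neg, v.map_mul, map_inv₀, inv_mul_eq_div]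
    gcongr
    exact hgrad i
  have h1 := hA g u (E / v γ)
    (fun i => (hG i z hz).trans ((Finset.single_le_sum (f := G) (fun j _ => hG0 j)
      (Finset.mem_univ i)).trans (by linarith))) hur (by positivity)
    ((div_le_self hE hγ).trans (by linarith))
  have hFz : v (eval z F) ≤ E / v γ := by
    rw [le_div_iff₀ hγ0, mul_comm, ← v.map_mul]
    exact hF
  have h2 : v (eval g D) ≤ E / v γ * B := by
    rw [hg, hQ, v.map_mul]
    exact mul_le_mul hFz (hB z hz) (v.nonneg _) (by positivity)
  have h3 : v (eval (g + u) D) ≤ A * (E / v γ) + E / v γ * B := by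
    have := v.add_le (eval (g + u) D - eval g D) (eval g D)
    rw [sub_add_cancel] at this
    linarith
  rw [hw, eval_mul_of_isHomogeneous hD, v.map_mul, map_pow, v.map_neg]
  calc v γ ^ (d + 1) * v (eval (g + u) D) ≤ v γ ^ (d + 1) * (A * (E / v γ) + E / v γ * B) := by
        gcongr
    _ = _ := by
        field_simp
        ring

/-- The bound for the dual form at `w` that follows from an approximate critical point `x` of the
phase `γ F(x) + w · x` at which the phase is bounded. -/
theorem exists_eval_dual_le_of_approx_critical [Nonempty σ] {F D Q : MvPolynomial σ L} {d : ℕ}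
    (hF : F.IsHomogeneous 3) (hD : D.IsHomogeneous (d + 1))
    (hQ : ∀ x : σ → L, eval (fun i => eval x (pderiv i F)) D = eval x F * eval x Q)
    (h2 : (2 : L) ≠ 0) {c M : ℝ} (hc : 0 < c) (hM : 1 ≤ M) :
    ∃ C : ℝ, ∀ (γ : L) (w x : σ → L) (r W : ℝ),
      (∀ i, v (x i) ≤ 1) → c ≤ v (hessianAt F x).det → 1 ≤ r → v γ ≤ r ^ 2 →
      r ^ 2 ≤ M * max 1 (v γ) → (∀ i, v (γ * eval x (pderiv i F) + w i) ≤ M * r) →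
      v (γ * eval x F + ∑ i, w i * x i) ≤ 1 → (∀ i, v (w i) ≤ W) → 0 ≤ W →
      v (eval w D) ≤ C * (1 + W ^ d) := by
  obtain ⟨A, hA0, hA⟩ := exists_scale_le v hF hc hM
  obtain ⟨E, hE0, hE⟩ := exists_newton_step v hF h2 hc hM
  obtain ⟨B, hB0, hB⟩ := exists_eval_dual_le v hD hQ hE0
  choose G hG0 hG using fun i => exists_eval_le v (pderiv i F) 1
  have hGsum : 0 ≤ ∑ i, G i := Finset.sum_nonneg fun i _ => hG0 i
  obtain ⟨K, hK0, hK⟩ := exists_eval_le v D (M * M + ∑ i, G i)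
  refine ⟨K + B * (A ^ d * 2 ^ d), fun γ w x r W hx hdet hr hγ hγ' he hφ hw hW => ?_⟩
  have hWd : 0 ≤ W ^ d := by positivity
  rcases le_total (v γ) 1 with h | h
  · rw [max_eq_left h, mul_one] at hγ'
    have h1 : v (eval w D) ≤ K := by
      refine hK w fun i => ?_
      have h3 := v.sub_le_add (γ * eval x (pderiv i F) + w i) (γ * eval x (pderiv i F))
      rw [add_sub_cancel_left] at h3
      have h4 : v (γ * eval x (pderiv i F)) ≤ ∑ i, G i := by
        rw [v.map_mul]
        refine (mul_le_of_le_one_left (v.nonneg _) h).trans ((hG i x hx).trans ?_)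
        exact Finset.single_le_sum (f := G) (fun j _ => hG0 j) (Finset.mem_univ i)
      have h5 : M * r ≤ M * M := by
        gcongr
        nlinarith
      linarith [he i]
    have h3 : 0 ≤ B * (A ^ d * 2 ^ d) := by positivity
    nlinarith
  · rw [max_eq_right h] at hγ'
    have h1 := hA γ w x r W hx hdet hγ hγ' he hw hW
    obtain ⟨z, hz, hz1, hz2⟩ := hE γ w x r hx hdet hr hγ hγ' he hφ
    have h3 := hB γ w z h hz hz1 hz2
    have h4 : v γ ^ d ≤ A ^ d * 2 ^ d * (1 + W ^ d) := by
      calc v γ ^ d ≤ (A * (1 + W)) ^ d := by gcongr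
        _ = A ^ d * (1 + W) ^ d := mul_pow _ _ _
        _ ≤ A ^ d * (2 ^ d * (1 + W ^ d)) := by
          gcongr
          refine (add_pow_le zero_le_one hW d).trans ?_
          rw [one_pow]
          gcongr
          · norm_num
          · omega
        _ = _ := by ring
    calc v (eval w D) ≤ B * v γ ^ d := h3
      _ ≤ B * (A ^ d * 2 ^ d * (1 + W ^ d)) := by gcongr
      _ ≤ _ := by nlinarith

end Core

/-! ### The absolute value, the topology, the measure and the character of `k((t⁻¹))` -/

section AbsInf

variable {k : Type*} [Field k]

theorem absInf_zero : absInf (0 : k⸨X⸩) = 0 := if_pos rfl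

theorem absInf_of_ne_zero {α : k⸨X⸩} (h : α ≠ 0) :
    absInf α = (Nat.card k : ℝ) ^ (-α.order) := if_neg h

variable [Finite k]

theorem one_lt_card : (1 : ℝ) < Nat.card k := by exact_mod_cast Finite.one_lt_card

theorem absInf_pos {α : k⸨X⸩} (h : α ≠ 0) : 0 < absInf α := by
  rw [absInf_of_ne_zero h]
  exact zpow_pos (zero_lt_one.trans one_lt_card) _

theorem absInf_nonneg (α : k⸨X⸩) : 0 ≤ absInf α := by
  by_cases h : α = 0
  · rw [h, absInf_zero]
  · exact (absInf_pos h).le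

theorem absInf_mul (α β : k⸨X⸩) : absInf (α * β) = absInf α * absInf β := by
  by_cases hα : α = 0
  · simp [hα, absInf_zero]
  by_cases hβ : β = 0
  · simp [hβ, absInf_zero]
  rw [absInf_of_ne_zero hα, absInf_of_ne_zero hβ, absInf_of_ne_zero (mul_ne_zero hα hβ),
    HahnSeries.order_mul hα hβ, ← zpow_add₀ (zero_lt_one.trans one_lt_card).ne', neg_add]

theorem absInf_add_le_max (α β : k⸨X⸩) : absInf (α + β) ≤ max (absInf α) (absInf β) := by
  by_cases hα : α = 0
  · simp [hα]
  by_cases hβ : β = 0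
  · simp [hβ]
  by_cases h : α + β = 0
  · rw [h, absInf_zero]
    exact (absInf_nonneg α).trans (le_max_left _ _)
  rw [absInf_of_ne_zero hα, absInf_of_ne_zero hβ, absInf_of_ne_zero h, le_max_iff,
    zpow_le_zpow_iff_right₀ one_lt_card, zpow_le_zpow_iff_right₀ one_lt_card]
  have := HahnSeries.min_order_le_order_add h
  rw [min_le_iff] at this
  omega

variable (k) in
/-- `absInf` as an absolute value. -/
noncomputable def absVal : AbsoluteValue k⸨X⸩ ℝ where
  toFun := absInf
  map_mul' := absInf_mul
  nonneg' := absInf_nonneg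
  eq_zero' α := ⟨fun h => by_contra fun h1 => (absInf_pos h1).ne' h, fun h => by
    rw [h, absInf_zero]⟩
  add_le' α β := (absInf_add_le_max α β).trans
    (max_le (le_add_of_nonneg_right (absInf_nonneg β)) (le_add_of_nonneg_left (absInf_nonneg α)))

theorem absVal_apply (α : k⸨X⸩) : absVal k α = absInf α := rfl

theorem absInf_neg (α : k⸨X⸩) : absInf (-α) = absInf α := (absVal k).map_neg α

theorem absInf_one : absInf (1 : k⸨X⸩) = 1 := (absVal k).map_one

theorem absInf_inv (α : k⸨X⸩) : absInf α⁻¹ = (absInf α)⁻¹ := map_inv₀ (absVal k) α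

theorem absInf_add_lt {α β : k⸨X⸩} {r : ℝ} (hα : absInf α < r) (hβ : absInf β < r) :
    absInf (α + β) < r := (absInf_add_le_max α β).trans_lt (max_lt hα hβ)

theorem absInf_lt_iff (α : k⸨X⸩) (M : ℤ) :
    absInf α < (Nat.card k : ℝ) ^ M ↔ ∀ m : ℤ, m ≤ -M → α.coeff m = 0 := by
  by_cases h : α = 0
  · simp [h, absInf_zero, zpow_pos (zero_lt_one.trans (one_lt_card (k := k)))]
  rw [absInf_of_ne_zero h, zpow_lt_zpow_iff_right₀ one_lt_card]
  constructor
  · intro h2 m hm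
    exact HahnSeries.coeff_eq_zero_of_lt_order (by omega)
  · intro h2
    by_contra h3
    exact h (HahnSeries.coeff_order_eq_zero.1 (h2 _ (by omega)))

omit [Finite k] in
theorem absInf_single (m : ℤ) {a : k} (ha : a ≠ 0) :
    absInf (HahnSeries.single m a) = (Nat.card k : ℝ) ^ (-m) := by
  rw [absInf_of_ne_zero (by simpa using ha), HahnSeries.order_single ha]

theorem absInf_one_add {s : k⸨X⸩} (hs : s ∈ unitBall k) : absInf (1 + s) = 1 := by
  have hs1 : absInf s < 1 := hs
  have h1 := absInf_add_le_max 1 s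
  have h2 := absInf_add_le_max (1 + s) (-s)
  rw [add_neg_cancel_right, absInf_neg, absInf_one] at h2
  rw [absInf_one] at h1
  rcases le_max_iff.1 h2 with h | h
  · exact le_antisymm (h1.trans (max_le le_rfl hs1.le)) h
  · linarith

omit [Finite k] in
theorem polyEmb_injective : Function.Injective (polyEmb k) := by
  rw [injective_iff_map_eq_zero]
  intro f hf
  ext i
  have hterm : ∀ (m : ℕ) (a : k), HahnSeries.C a * tInf k ^ m =
      HahnSeries.single (-(m : ℤ)) a := by
    intro m a
    rw [tInf, HahnSeries.single_pow, HahnSeries.C_apply, HahnSeries.single_mul_single]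
    simp
  have h1 : (polyEmb k f).coeff (-(i : ℤ)) = f.coeff i := by
    rw [polyEmb, Polynomial.coe_eval₂RingHom, Polynomial.eval₂_eq_sum, Polynomial.sum]
    simp_rw [hterm]
    rw [HahnSeries.coeff_sum]
    simp [HahnSeries.coeff_single, eq_comm]
  rw [← h1, hf]
  simp

omit [Finite k] in
theorem evalInf_eq {n : ℕ} (F : MvPolynomial (Fin n) k[X]) (x : Fin n → k⸨X⸩) :
    evalInf F x = eval x (map (polyEmb k) F) := by
  rw [evalInf, eval_map]

omit [Finite k] in
theorem supNorm_lt_iff {n : ℕ} [Nonempty (Fin n)] (x : Fin n → k⸨X⸩) (r : ℝ) :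
    supNorm x < r ↔ ∀ i, absInf (x i) < r := by
  refine ⟨fun h i => (le_ciSup (Set.finite_range _).bddAbove i).trans_lt h, fun h => ?_⟩
  obtain ⟨i, hi⟩ := exists_eq_ciSup_of_finite (f := fun i => absInf (x i))
  rw [supNorm, ← hi]
  exact h i

omit [Finite k] in
theorem absInf_le_supNorm {n : ℕ} (x : Fin n → k⸨X⸩) (i : Fin n) : absInf (x i) ≤ supNorm x :=
  le_ciSup (f := fun i => absInf (x i)) (Set.finite_range _).bddAbove i

theorem supNorm_nonneg {n : ℕ} (x : Fin n → k⸨X⸩) : 0 ≤ supNorm x :=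
  Real.iSup_nonneg fun _ => absInf_nonneg _

theorem isOpen_ball (M : ℤ) : IsOpen {α : k⸨X⸩ | absInf α < (Nat.card k : ℝ) ^ M} := by
  have hne : (HahnSeries.single (M : ℤ) (1 : k)) ≠ 0 := by simp
  have h1 : {α : k⸨X⸩ | absInf α < (Nat.card k : ℝ) ^ M} =
      (fun α => HahnSeries.single M (1 : k) * α) ⁻¹' unitBall k := by
    ext α
    rw [Set.mem_preimage, unitBall, Set.mem_ofPred_eq, Set.mem_ofPred_eq, absInf_mul,
      absInf_single M one_ne_zero, zpow_neg, inv_mul_lt_iff₀ (zpow_pos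
        (zero_lt_one.trans one_lt_card) _), mul_one]
  rw [h1]
  exact isOpen_unitBall.preimage (continuous_const_mul _)

theorem exists_ball_subset {U : Set k⸨X⸩} (hU : U ∈ 𝓝 (0 : k⸨X⸩)) :
    ∃ M : ℤ, {α : k⸨X⸩ | absInf α < (Nat.card k : ℝ) ^ M} ⊆ U := by
  rw [Valued.mem_nhds_zero] at hU
  obtain ⟨γ, hγ⟩ := hU
  simp_rw [Valuation.restrict_lt_iff_lt_embedding] at hγ
  set g := MonoidWithZeroHom.ValueGroup₀.embedding γ.1 with hg
  have hg0 : g ≠ 0 := by simp [hg]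
  refine ⟨WithZero.log g - 1, fun α hα => hγ ?_⟩
  have hNg : WithZero.exp (WithZero.log g - 1) < g := by
    rw [← WithZero.lt_log_iff_exp_lt hg0]
    simp
  refine lt_of_le_of_lt ?_ hNg
  rw [← neg_neg (WithZero.log g - 1), LaurentSeries.valuation_le_iff_coeff_lt_eq_zero]
  intro m hm
  exact (absInf_lt_iff _ _).1 hα m (by omega)

instance : (𝓝 (0 : k⸨X⸩)).IsCountablyGenerated := by
  have h : (𝓝 (0 : k⸨X⸩)).HasBasis (fun _ : ℤ => True)
      fun M => {α : k⸨X⸩ | absInf α < (Nat.card k : ℝ) ^ M} := by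
    refine ⟨fun U => ⟨fun hU => ?_, fun ⟨M, _, hM⟩ => Filter.mem_of_superset ?_ hM⟩⟩
    · obtain ⟨M, hM⟩ := exists_ball_subset hU
      exact ⟨M, trivial, hM⟩
    · refine (isOpen_ball M).mem_nhds ?_
      rw [Set.mem_ofPred_eq, absInf_zero]
      exact zpow_pos (zero_lt_one.trans one_lt_card) _
  exact h.isCountablyGenerated

theorem isCompact_ball (M : ℤ) : IsCompact {α : k⸨X⸩ | absInf α < (Nat.card k : ℝ) ^ M} := by
  have h1 : {α : k⸨X⸩ | absInf α < (Nat.card k : ℝ) ^ M} =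
      (fun α => HahnSeries.single (-M) (1 : k) * α) '' unitBall k := by
    ext α
    constructor
    · intro h
      refine ⟨HahnSeries.single M (1 : k) * α, ?_, ?_⟩
      · rw [unitBall, Set.mem_ofPred_eq, absInf_mul, absInf_single M one_ne_zero, zpow_neg,
          inv_mul_lt_iff₀ (zpow_pos (zero_lt_one.trans one_lt_card) _), mul_one]
        exact h
      · simp [← mul_assoc]
    · rintro ⟨β, hβ, rfl⟩
      have hβ1 : absInf β < 1 := hβ
      rw [Set.mem_ofPred_eq, absInf_mul, absInf_single _ one_ne_zero, neg_neg]
      exact mul_lt_of_lt_one_right (zpow_pos (zero_lt_one.trans one_lt_card) _) hβ1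
  rw [h1]
  exact isCompact_unitBall.image (continuous_const_mul _)

instance : SigmaCompactSpace k⸨X⸩ := by
  refine SigmaCompactSpace.of_countable
    (Set.range fun M : ℤ => {α : k⸨X⸩ | absInf α < (Nat.card k : ℝ) ^ M})
    (Set.countable_range _) ?_ ?_
  · rintro _ ⟨M, rfl⟩
    exact isCompact_ball M
  · ext α
    obtain ⟨N, hN⟩ := pow_unbounded_of_one_lt (absInf α) (one_lt_card (k := k))
    simp only [Set.sUnion_range, Set.mem_iUnion, Set.mem_univ, iff_true]
    exact ⟨(N : ℤ), by rw [Set.mem_ofPred_eq, zpow_natCast]; exact hN⟩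

instance : SecondCountableTopology k⸨X⸩ := by
  have : (uniformity k⸨X⸩).IsCountablyGenerated := IsUniformAddGroup.uniformity_countably_generated
  let _ := UniformSpace.pseudoMetricSpace k⸨X⸩
  exact EMetric.secondCountable_of_sigmaCompact k⸨X⸩

instance : (haar k).IsAddHaarMeasure := by
  unfold haar
  infer_instance

theorem haar_unitBall : haar k (unitBall k) = 1 :=
  MeasureTheory.Measure.addHaarMeasure_self (K₀ := unitBallCompacts k)

open MeasureTheory in
/-- Multiplication by an element of absolute value `1` preserves the Haar measure. -/
theorem measurePreserving_mul {u : k⸨X⸩} (hu : absInf u = 1) :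
    MeasurePreserving (fun α => u * α) (haar k) (haar k) := by
  have hu0 : u ≠ 0 := by
    rintro rfl
    simp [absInf_zero] at hu
  have hc : Continuous fun α : k⸨X⸩ => u * α := continuous_const_mul _
  refine ⟨hc.measurable, ?_⟩
  have h1 : (Measure.map (AddMonoidHom.mulLeft u) (haar k)).IsAddHaarMeasure :=
    Measure.isAddHaarMeasure_map (haar k) (AddMonoidHom.mulLeft u) hc
      (fun α => ⟨u⁻¹ * α, by simp [hu0]⟩)
      (Homeomorph.mulLeft₀ u hu0).isClosedEmbedding.tendsto_cocompact
  have h2 := Measure.addHaarMeasure_unique (Measure.map (AddMonoidHom.mulLeft u) (haar k))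
    (unitBallCompacts k)
  have h3 : Measure.map (AddMonoidHom.mulLeft u) (haar k) (unitBall k) = 1 := by
    rw [Measure.map_apply (f := AddMonoidHom.mulLeft u) hc.measurable
      isOpen_unitBall.measurableSet, ← haar_unitBall (k := k)]
    congr 1
    ext α
    simp [unitBall, absInf_mul, hu]
  have h4 : ((unitBallCompacts k : TopologicalSpace.PositiveCompacts k⸨X⸩) : Set k⸨X⸩) =
    unitBall k := rfl
  rw [h4, h3, one_smul] at h2
  exact h2

end AbsInf

section Character

variable {k : Type*} [Field k] (p : ℕ) [Fact p.Prime] [Algebra (ZMod p) k]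

theorem psi_add (α β : k⸨X⸩) : psi p (α + β) = psi p α * psi p β := by
  simp [psi, AddChar.map_add_eq_mul]

theorem psi_eq_one {α : k⸨X⸩} (h : α.coeff 1 = 0) : psi p α = 1 := by
  simp [psi, h]

theorem norm_psi (α : k⸨X⸩) : ‖psi p α‖ = 1 := AddChar.norm_apply _ _

variable [Finite k]

theorem continuous_psi : Continuous (psi p : k⸨X⸩ → ℂ) := by
  refine IsLocallyConstant.continuous ((IsLocallyConstant.iff_eventually_eq _).2 fun α => ?_)
  have h1 : (fun β => β - α) ⁻¹' {β : k⸨X⸩ | absInf β < (Nat.card k : ℝ) ^ (-1 : ℤ)} ∈ 𝓝 α := by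
    refine ((isOpen_ball (-1)).preimage (continuous_sub_right α)).mem_nhds ?_
    rw [Set.mem_preimage, sub_self, Set.mem_ofPred_eq, absInf_zero]
    exact zpow_pos (zero_lt_one.trans one_lt_card) _
  filter_upwards [h1] with β hβ
  have h2 := psi_eq_one p ((absInf_lt_iff _ _).1 hβ 1 (by omega))
  rw [← sub_add_cancel β α, psi_add, h2, one_mul]

theorem continuous_psi_comp {E : Type*} [TopologicalSpace E] {f : E → k⸨X⸩} (hf : Continuous f) :
    Continuous fun x => psi p (f x) := (continuous_psi p).comp hf

/-- `ψ` is nontrivial on every ball of radius at least `q⁻¹`. -/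
theorem exists_psi_mul_ne_one {z : k⸨X⸩} (hz : (Nat.card k : ℝ)⁻¹ ≤ absInf z) :
    ∃ a : k⸨X⸩, absInf a ≤ 1 ∧ psi p (a * z) ≠ 1 := by
  have hz0 : z ≠ 0 := by
    rintro rfl
    rw [absInf_zero] at hz
    have := inv_pos.2 (zero_lt_one.trans (one_lt_card (k := k)))
    linarith
  have : FiniteDimensional (ZMod p) k := Module.Finite.of_finite
  obtain ⟨l, hl⟩ : ∃ l : k, Algebra.trace (ZMod p) k l ≠ 0 := by
    by_contra! h
    exact Algebra.trace_ne_zero (ZMod p) k (LinearMap.ext h)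
  refine ⟨HahnSeries.single 1 l * z⁻¹, ?_, ?_⟩
  · have hl0 : l ≠ 0 := by
      rintro rfl
      simp at hl
    rw [absInf_mul, absInf_inv, absInf_single _ hl0, ← div_eq_mul_inv,
      div_le_one (absInf_pos hz0), zpow_neg_one]
    exact hz
  · rw [inv_mul_cancel_right₀ hz0, psi, HahnSeries.coeff_single_same]
    intro h
    exact hl (ZMod.injective_stdAddChar (h.trans (AddChar.map_zero_eq_one _).symm))

end Character

/-! ### Averaging and measure preserving maps of boxes -/

open MeasureTheory

section Averaging

/-- Averaging over a family of measure preserving maps does not change an integral. -/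
theorem integral_integral_orbit {X G : Type*} [MeasurableSpace X] [MeasurableSpace G]
    {μ : Measure X} {ν : Measure G} [SFinite μ] [IsFiniteMeasure ν]
    {T : G → X → X} {f : X → ℂ} (hT : ∀ᵐ g ∂ν, MeasurePreserving (T g) μ μ)
    (hf : AEStronglyMeasurable f μ)
    (hint : Integrable (fun z : X × G => f (T z.2 z.1)) (μ.prod ν)) :
    ∫ x, ∫ g, f (T g x) ∂ν ∂μ = ν.real Set.univ • ∫ x, f x ∂μ := by
  rw [integral_integral_swap hint, ← integral_const]
  refine integral_congr_ae ?_
  filter_upwards [hT] with g hg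
  have := integral_map (φ := T g) (f := f) hg.measurable.aemeasurable (by rwa [hg.map_eq])
  rw [← this, hg.map_eq]

/-- A character that is nontrivial on an invariant set has integral zero over it. -/
theorem setIntegral_char_eq_zero {E : Type*} [AddCommGroup E] [MeasurableSpace E] {μ : Measure E}
    {U : Set E} {y₀ : E} {χ : E → ℂ}
    (hU : MeasurePreserving (fun y => y + y₀) (μ.restrict U) (μ.restrict U))
    (hχ : AEStronglyMeasurable χ (μ.restrict U)) (hmul : ∀ y, χ (y + y₀) = χ y * χ y₀)
    (hne : χ y₀ ≠ 1) : ∫ y in U, χ y ∂μ = 0 := by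
  have h1 := integral_map (φ := fun y => y + y₀) (f := χ) hU.measurable.aemeasurable
    (by rwa [hU.map_eq])
  rw [hU.map_eq] at h1
  simp_rw [hmul] at h1
  rw [integral_mul_const] at h1
  by_contra h
  exact hne (mul_left_cancel₀ h (by rw [mul_one]; exact h1.symm))

end Averaging

section Boxes

variable {k : Type*} [Field k] [Finite k] {n : ℕ}

/-- The product of the balls of radius `q ^ M` around the coordinates of `x₀`. -/
def box (x₀ : Fin n → k⸨X⸩) (M : ℤ) : Set (Fin n → k⸨X⸩) :=
  {x | ∀ i, absInf (x i - x₀ i) < (Nat.card k : ℝ) ^ M}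

variable (k n) in
/-- The Haar measure on `k((t⁻¹))ⁿ`. -/
noncomputable abbrev haarPi : Measure (Fin n → k⸨X⸩) := Measure.pi fun _ => haar k

omit [Finite k] in
theorem box_eq_pi (x₀ : Fin n → k⸨X⸩) (M : ℤ) :
    box x₀ M = Set.univ.pi fun i =>
      (fun α => α - x₀ i) ⁻¹' {α : k⸨X⸩ | absInf α < (Nat.card k : ℝ) ^ M} := by
  ext x
  simp [box]

theorem isCompact_box (x₀ : Fin n → k⸨X⸩) (M : ℤ) : IsCompact (box x₀ M) := by
  rw [box_eq_pi]
  refine isCompact_univ_pi fun i => ?_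
  exact (Homeomorph.subRight (x₀ i)).isCompact_preimage.2 (isCompact_ball M)

theorem isOpen_box (x₀ : Fin n → k⸨X⸩) (M : ℤ) : IsOpen (box x₀ M) := by
  rw [box_eq_pi]
  exact isOpen_set_pi Set.finite_univ fun i _ => (isOpen_ball M).preimage (continuous_sub_right _)

theorem measurableSet_box (x₀ : Fin n → k⸨X⸩) (M : ℤ) : MeasurableSet (box x₀ M) :=
  (isOpen_box x₀ M).measurableSet

instance (x₀ : Fin n → k⸨X⸩) (M : ℤ) : IsFiniteMeasure ((haarPi k n).restrict (box x₀ M)) :=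
  isFiniteMeasure_restrict.2 (isCompact_box x₀ M).measure_lt_top.ne

instance (M : ℤ) :
    IsFiniteMeasure ((haar k).restrict {α : k⸨X⸩ | absInf α < (Nat.card k : ℝ) ^ M}) :=
  isFiniteMeasure_restrict.2 (isCompact_ball M).measure_lt_top.ne

instance : IsProbabilityMeasure ((haar k).restrict (unitBall k)) :=
  ⟨by rw [Measure.restrict_apply_univ, haar_unitBall]⟩

instance (M : ℤ) : NeZero ((haarPi k n).restrict (box (0 : Fin n → k⸨X⸩) M)) := by
  refine ⟨fun h => ?_⟩
  rw [Measure.restrict_eq_zero] at h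
  refine ((isOpen_box 0 M).measure_pos (haarPi k n) ⟨0, fun i => ?_⟩).ne' h
  rw [sub_self, absInf_zero]
  exact zpow_pos (zero_lt_one.trans one_lt_card) _

theorem absInf_le_one_of_mem_box {x₀ : Fin n → k⸨X⸩} (hx₀ : ∀ i, absInf (x₀ i) ≤ 1)
    {x : Fin n → k⸨X⸩} (hx : x ∈ box x₀ 0) (i : Fin n) : absInf (x i) ≤ 1 := by
  have h1 := absInf_add_le_max (x i - x₀ i) (x₀ i)
  rw [sub_add_cancel] at h1
  have h2 := hx i
  rw [zpow_zero] at h2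
  exact h1.trans (max_le h2.le (hx₀ i))

theorem measurePreserving_add_box (x₀ : Fin n → k⸨X⸩) {M N : ℤ} (hMN : M ≤ N)
    {y : Fin n → k⸨X⸩} (hy : y ∈ box 0 M) :
    MeasurePreserving (fun x => x + y) ((haarPi k n).restrict (box x₀ N))
      ((haarPi k n).restrict (box x₀ N)) := by
  have hy' : ∀ i, absInf (y i) < (Nat.card k : ℝ) ^ N := fun i => by
    have := hy i
    rw [Pi.zero_apply, sub_zero] at this
    exact this.trans_le (zpow_le_zpow_right₀ one_lt_card.le hMN)
  have h := (measurePreserving_add_right (haarPi k n) y).restrict_preimage (measurableSet_box x₀ N)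
  convert h using 2
  ext x
  refine forall_congr' fun i => ⟨fun h1 => ?_, fun h1 => ?_⟩
  · have := absInf_add_lt h1 (hy' i)
    rwa [sub_add_eq_add_sub] at this
  · have := absInf_add_lt h1 ((absInf_neg (y i)).trans_lt (hy' i))
    change absInf (x i + y i - x₀ i + -y i) < _ at this
    rwa [add_sub_right_comm, add_neg_cancel_right] at this

theorem measurePreserving_add_unitBall {s : k⸨X⸩} (hs : s ∈ unitBall k) :
    MeasurePreserving (fun α => α + s) ((haar k).restrict (unitBall k))
      ((haar k).restrict (unitBall k)) := by
  have h := (measurePreserving_add_right (haar k) s).restrict_preimage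
    (isOpen_unitBall (k := k)).measurableSet
  convert h using 2
  ext α
  refine ⟨fun h1 => absInf_add_lt h1 hs, fun h1 => ?_⟩
  have := absInf_add_lt h1 ((absInf_neg s).trans_lt hs)
  rwa [add_neg_cancel_right] at this

theorem measurePreserving_mul_ball {u : k⸨X⸩} (hu : absInf u = 1) (M : ℤ) :
    MeasurePreserving (fun α => u * α)
      ((haar k).restrict {α : k⸨X⸩ | absInf α < (Nat.card k : ℝ) ^ M})
      ((haar k).restrict {α : k⸨X⸩ | absInf α < (Nat.card k : ℝ) ^ M}) := by
  have h := (measurePreserving_mul hu).restrict_preimage (isOpen_ball (k := k) M).measurableSet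
  convert h using 2
  ext α
  simp [absInf_mul, hu]

theorem measurePreserving_mul_box {x₀ : Fin n → k⸨X⸩} (hx₀ : ∀ i, absInf (x₀ i) ≤ 1)
    {s : k⸨X⸩} (hs : s ∈ unitBall k) :
    MeasurePreserving (fun x i => (1 + s) * x i) ((haarPi k n).restrict (box x₀ 0))
      ((haarPi k n).restrict (box x₀ 0)) := by
  have hu := absInf_one_add hs
  have h := (measurePreserving_pi (fun _ : Fin n => haar k) (fun _ => haar k)
    (f := fun _ α => (1 + s) * α) fun _ => measurePreserving_mul hu).restrict_preimage
    (measurableSet_box x₀ 0)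
  convert h using 2
  ext x
  have hlt : ∀ i, absInf (x i) ≤ 1 → absInf (s * x i) < (Nat.card k : ℝ) ^ (0 : ℤ) := by
    intro i hi
    have hs1 : absInf s < 1 := hs
    rw [absInf_mul, zpow_zero]
    exact (mul_le_of_le_one_right (absInf_nonneg _) hi).trans_lt hs1
  constructor
  · intro hx i
    have := absInf_add_lt (hx i) (hlt i (absInf_le_one_of_mem_box hx₀ hx i))
    convert this using 2
    ring
  · intro hx i
    have h1 := absInf_le_one_of_mem_box hx₀ hx i
    rw [absInf_mul, hu, one_mul] at h1
    have := absInf_add_lt (hx i) ((absInf_neg _).trans_lt (hlt i h1))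
    convert this using 2
    ring

end Boxes

/-! ### Localisation of the oscillatory integral -/

section Phase

variable {k : Type*} [Field k] [Finite k] {n : ℕ} (p : ℕ) [Fact p.Prime] [Algebra (ZMod p) k]

/-- If `ψ(b y) = 1` for all `|y| < q ^ M`, then `|b| ≤ q ^ (-M)`. -/
theorem absInf_le_of_psi_eq_one {b : k⸨X⸩} {M : ℤ}
    (h : ∀ y : k⸨X⸩, absInf y < (Nat.card k : ℝ) ^ M → psi p (y * b) = 1) :
    absInf b ≤ (Nat.card k : ℝ) ^ (-M) := by
  by_contra! hb
  have hq : (0 : ℝ) < Nat.card k := zero_lt_one.trans one_lt_card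
  have he : absInf (HahnSeries.single (1 - M) (1 : k)) = (Nat.card k : ℝ) ^ (M - 1) := by
    rw [absInf_single _ one_ne_zero, neg_sub]
  obtain ⟨a, ha, hne⟩ := exists_psi_mul_ne_one p (z := HahnSeries.single (1 - M) (1 : k) * b) (by
    rw [absInf_mul, he]
    calc (Nat.card k : ℝ)⁻¹ = (Nat.card k : ℝ) ^ (M - 1) * (Nat.card k : ℝ) ^ (-M) := by
          rw [← zpow_add₀ hq.ne', ← zpow_neg_one]
          congr 1
          ring
      _ ≤ _ := by gcongr)
  refine hne ?_
  rw [← mul_assoc]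
  refine h _ ?_
  rw [absInf_mul, he]
  refine (mul_le_of_le_one_left (zpow_pos hq _).le ha).trans_lt ?_
  exact zpow_lt_zpow_right₀ one_lt_card (by omega)

/-- The combined average over scalings and translations of a character with affine linear phase
vanishes, unless both the constant term and the gradient of the phase are small. -/
theorem small_of_integral_affine_ne_zero {a : k⸨X⸩} {b : Fin n → k⸨X⸩} {M : ℤ}
    (h : ∫ y in box (0 : Fin n → k⸨X⸩) M, ∫ s in unitBall k,
      psi p ((1 + s) * (a + ∑ i, y i * b i)) ∂(haar k) ∂(haarPi k n) ≠ 0) :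
    absInf a ≤ 1 ∧ ∀ i, absInf (b i) ≤ (Nat.card k : ℝ) ^ (-M) := by
  have hmul : ∀ (s : k⸨X⸩) (y : Fin n → k⸨X⸩), psi p ((1 + s) * (a + ∑ i, y i * b i)) =
      psi p ((1 + s) * a) * psi p ((1 + s) * ∑ i, y i * b i) := fun s y => by
    rw [mul_add, psi_add]
  have hlin : Continuous fun y : Fin n → k⸨X⸩ => ∑ i, y i * b i :=
    continuous_finsetSum _ fun i _ => (continuous_apply i).mul continuous_const
  have hcont : ∀ s : k⸨X⸩, Continuous fun y : Fin n → k⸨X⸩ => psi p ((1 + s) * ∑ i, y i * b i) :=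
    fun s => continuous_psi_comp p (continuous_const.mul hlin)
  have hU : ∀ y ∈ (box 0 M : Set (Fin n → k⸨X⸩)), ∀ s ∈ unitBall k,
      psi p ((1 + s) * ∑ i, y i * b i) = 1 := by
    by_contra! hne
    obtain ⟨y₀, hy₀, s₀, hs₀, hne⟩ := hne
    refine h ?_
    rw [integral_integral_swap]
    · refine setIntegral_eq_zero_of_forall_eq_zero fun s hs => ?_
      simp_rw [hmul]
      rw [integral_const_mul]
      refine mul_eq_zero_of_right _ ?_
      have hs1 : (1 + s) ≠ 0 := fun h0 => by
        have := absInf_one_add hs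
        rw [h0, absInf_zero] at this
        exact zero_ne_one this
      -- Rescaling `y₀` moves the value of the character from `s₀` to `s`.
      refine setIntegral_char_eq_zero (y₀ := fun i => (1 + s)⁻¹ * (1 + s₀) * y₀ i)
        (measurePreserving_add_box 0 le_rfl fun i => ?_) (hcont s).aestronglyMeasurable
        (fun y => ?_) ?_
      · have := hy₀ i
        rw [Pi.zero_apply, sub_zero] at this ⊢
        rwa [absInf_mul, absInf_mul, absInf_inv, absInf_one_add hs, absInf_one_add hs₀, inv_one,
          one_mul, one_mul]
      · rw [← psi_add, ← mul_add, ← Finset.sum_add_distrib]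
        simp_rw [Pi.add_apply, add_mul]
      · have h1 : (1 + s) * ∑ i, (1 + s)⁻¹ * (1 + s₀) * y₀ i * b i =
            (1 + s₀) * ∑ i, y₀ i * b i := by
          simp_rw [mul_assoc, ← Finset.mul_sum]
          rw [mul_inv_cancel_left₀ hs1]
        rwa [h1]
    · have hc : Continuous fun z : (Fin n → k⸨X⸩) × k⸨X⸩ =>
          psi p ((1 + z.2) * (a + ∑ i, z.1 i * b i)) :=
        continuous_psi_comp p ((continuous_const.add continuous_snd).mul
          (continuous_const.add (hlin.comp continuous_fst)))
      exact Integrable.of_bound hc.aestronglyMeasurable 1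
        (Filter.Eventually.of_forall fun z => (norm_psi p _).le)
  have h1 : ∫ s in unitBall k, psi p ((1 + s) * a) ∂(haar k) ≠ 0 := by
    intro h0
    refine h (setIntegral_eq_zero_of_forall_eq_zero fun y hy => ?_)
    rw [← h0]
    refine setIntegral_congr_fun isOpen_unitBall.measurableSet fun s hs => ?_
    simp only [hmul, hU y hy s hs, mul_one]
  constructor
  · have := absInf_le_of_psi_eq_one p (b := a) (M := 0) fun s hs => ?_
    · simpa using this
    · by_contra hne
      refine h1 ?_
      have h2 : ∀ s : k⸨X⸩, psi p ((1 + s) * a) = psi p a * psi p (s * a) := fun s => by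
        rw [← psi_add]; congr 1; ring
      simp_rw [h2]
      rw [integral_const_mul]
      refine mul_eq_zero_of_right _ (setIntegral_char_eq_zero (y₀ := s)
        (measurePreserving_add_unitBall (by rwa [zpow_zero] at hs)) ?_ (fun t => ?_) hne)
      · exact (continuous_psi_comp p (continuous_id.mul continuous_const)).aestronglyMeasurable
      · rw [add_mul, psi_add]
  · intro i
    refine absInf_le_of_psi_eq_one p fun y hy => ?_
    have h2 := hU (Pi.single i y) (fun j => ?_) 0 (by simp [unitBall, absInf_zero])
    · rw [add_zero, one_mul, Finset.sum_eq_single i (fun j _ hj => by simp [hj]) (by simp),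
        Pi.single_eq_same] at h2
      exact h2
    · rw [Pi.zero_apply, sub_zero]
      by_cases hj : j = i
      · subst hj; simpa using hy
      · rw [Pi.single_eq_of_ne hj, absInf_zero]
        exact zpow_pos (zero_lt_one.trans one_lt_card) _

/-- The phase `γ F(x) + w · x`. -/
noncomputable def phase (P : MvPolynomial (Fin n) k⸨X⸩) (γ : k⸨X⸩) (w x : Fin n → k⸨X⸩) : k⸨X⸩ :=
  γ * eval x P + ∑ i, w i * x i

omit [Finite k] in
theorem continuous_phase (P : MvPolynomial (Fin n) k⸨X⸩) (w : Fin n → k⸨X⸩) :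
    Continuous fun z : k⸨X⸩ × (Fin n → k⸨X⸩) => phase P z.1 w z.2 := by
  have := MvPolynomial.continuous_eval P
  unfold phase
  fun_prop

omit [Finite k] in
theorem continuous_phase_right (P : MvPolynomial (Fin n) k⸨X⸩) (γ : k⸨X⸩) (w : Fin n → k⸨X⸩) :
    Continuous fun x : Fin n → k⸨X⸩ => phase P γ w x := by
  have := MvPolynomial.continuous_eval P
  unfold phase
  fun_prop

/-- The substitution `x ↦ u x`, `γ ↦ u⁻² γ` with `|u - 1| < 1` multiplies the phase by `u`, by
homogeneity of `F`. Averaging over `u` gives a nonvanishing inner integral for some `γ`. -/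
theorem exists_scaling_average_ne_zero {P : MvPolynomial (Fin n) k⸨X⸩} (hP : P.IsHomogeneous 3)
    {x₀ : Fin n → k⸨X⸩} (hx₀ : ∀ i, absInf (x₀ i) ≤ 1) {Γ : ℤ} {w : Fin n → k⸨X⸩}
    (h : ∫ γ in {γ : k⸨X⸩ | absInf γ < (Nat.card k : ℝ) ^ Γ}, ∫ x in box x₀ 0,
      psi p (phase P γ w x) ∂(haarPi k n) ∂(haar k) ≠ 0) :
    ∃ γ : k⸨X⸩, ∫ x in box x₀ 0, ∫ s in unitBall k, psi p ((1 + s) * phase P γ w x) ∂(haar k)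
      ∂(haarPi k n) ≠ 0 := by
  by_contra! h0
  have hcont := continuous_psi_comp p (continuous_phase P w)
  have hcont' : Continuous fun z : (k⸨X⸩ × (Fin n → k⸨X⸩)) × k⸨X⸩ =>
      psi p ((1 + z.2) * phase P z.1.1 w z.1.2) :=
    continuous_psi_comp p ((continuous_const.add continuous_snd).mul
      ((continuous_phase P w).comp continuous_fst))
  let T : k⸨X⸩ → k⸨X⸩ × (Fin n → k⸨X⸩) → k⸨X⸩ × (Fin n → k⸨X⸩) := fun s =>
    Prod.map (fun γ => ((1 + s) ^ 2)⁻¹ * γ) (fun x i => (1 + s) * x i)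
  have hTphase : ∀ s z, phase P (T s z).1 w (T s z).2 = (1 + s) * phase P z.1 w z.2 := by
    intro s z
    simp only [phase, T, Prod.map_fst, Prod.map_snd]
    rw [eval_mul_of_isHomogeneous hP, mul_add, Finset.mul_sum]
    congr 1
    · by_cases hs : 1 + s = 0
      · simp [hs]
      · field_simp
    · exact Finset.sum_congr rfl fun i _ => by ring
  set μ := ((haar k).restrict {γ : k⸨X⸩ | absInf γ < (Nat.card k : ℝ) ^ Γ}).prod
    ((haarPi k n).restrict (box x₀ 0)) with hμ
  have hint : Integrable (fun z : (k⸨X⸩ × (Fin n → k⸨X⸩)) × k⸨X⸩ =>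
      psi p ((1 + z.2) * phase P z.1.1 w z.1.2)) (μ.prod ((haar k).restrict (unitBall k))) :=
    Integrable.of_bound hcont'.aestronglyMeasurable 1
      (Filter.Eventually.of_forall fun z => (norm_psi p _).le)
  have havg := integral_integral_orbit (μ := μ) (ν := (haar k).restrict (unitBall k)) (T := T)
    (f := fun z => psi p (phase P z.1 w z.2)) ?_ hcont.aestronglyMeasurable
    (by simpa only [hTphase] using hint)
  · simp only [hTphase, probReal_univ, one_smul] at havg
    rw [hμ, integral_prod _ hint.integral_prod_left] at havg
    simp only [h0, integral_zero] at havg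
    rw [integral_prod _ (Integrable.of_bound hcont.aestronglyMeasurable 1
      (Filter.Eventually.of_forall fun z => (norm_psi p _).le))] at havg
    exact h havg.symm
  · refine (ae_restrict_iff' isOpen_unitBall.measurableSet).2 (Filter.Eventually.of_forall
      fun s hs => ?_)
    have hu : absInf (((1 + s) ^ 2)⁻¹) = 1 := by
      rw [absInf_inv, sq, absInf_mul, absInf_one_add hs, mul_one, inv_one]
    exact (measurePreserving_mul_ball hu Γ).prod (measurePreserving_mul_box hx₀ hs)

/-- The box of radius `1` is invariant under small translations, so the inner integral may be
averaged over them; the average is nonzero at some point. -/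
theorem exists_translation_average_ne_zero {P : MvPolynomial (Fin n) k⸨X⸩}
    {x₀ : Fin n → k⸨X⸩} {γ : k⸨X⸩} {w : Fin n → k⸨X⸩} {M : ℤ} (hM : M ≤ 0)
    (h : ∫ x in box x₀ 0, ∫ s in unitBall k, psi p ((1 + s) * phase P γ w x) ∂(haar k)
      ∂(haarPi k n) ≠ 0) :
    ∃ x ∈ box x₀ 0, ∫ y in box (0 : Fin n → k⸨X⸩) M, ∫ s in unitBall k,
      psi p ((1 + s) * phase P γ w (x + y)) ∂(haar k) ∂(haarPi k n) ≠ 0 := by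
  by_contra! h0
  have hcont : Continuous fun z : (Fin n → k⸨X⸩) × k⸨X⸩ =>
      psi p ((1 + z.2) * phase P γ w z.1) :=
    continuous_psi_comp p ((continuous_const.add continuous_snd).mul
      ((continuous_phase_right P γ w).comp continuous_fst))
  have hmeas : StronglyMeasurable fun x : Fin n → k⸨X⸩ =>
      ∫ s in unitBall k, psi p ((1 + s) * phase P γ w x) ∂(haar k) :=
    hcont.stronglyMeasurable.integral_prod_right
  have hbound : ∀ x : Fin n → k⸨X⸩,
      ‖∫ s in unitBall k, psi p ((1 + s) * phase P γ w x) ∂(haar k)‖ ≤ 1 := fun x => by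
    have := norm_integral_le_of_norm_le_const (μ := (haar k).restrict (unitBall k))
      (f := fun s => psi p ((1 + s) * phase P γ w x)) (C := 1)
      (Filter.Eventually.of_forall fun s => (norm_psi p _).le)
    simpa using this
  have havg := integral_integral_orbit (μ := (haarPi k n).restrict (box x₀ 0))
    (ν := (haarPi k n).restrict (box (0 : Fin n → k⸨X⸩) M)) (T := fun y x => x + y)
    (f := fun x => ∫ s in unitBall k, psi p ((1 + s) * phase P γ w x) ∂(haar k))
    ?_ hmeas.aestronglyMeasurable ?_
  · rw [setIntegral_eq_zero_of_forall_eq_zero h0, eq_comm, smul_eq_zero] at havg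
    exact havg.elim (measureReal_univ_pos
      (μ := (haarPi k n).restrict (box (0 : Fin n → k⸨X⸩) M))).ne' h
  · refine (ae_restrict_iff' (measurableSet_box 0 M)).2 (Filter.Eventually.of_forall
      fun y hy => measurePreserving_add_box x₀ hM hy)
  · exact Integrable.of_bound
      (hmeas.comp_measurable (measurable_fst.add measurable_snd)).aestronglyMeasurable 1
      (Filter.Eventually.of_forall fun z => hbound _)

/-- If `J^Γ(w) ≠ 0`, then for some `γ` the phase `γ F(x) + w · x` has an approximate critical point
in the ball at which it is bounded. The number `r` is `|γ|^(1/2)`, rounded to a power of `q` and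
bounded below by `1`. -/
theorem exists_approx_critical_point {P : MvPolynomial (Fin n) k⸨X⸩} (hP : P.IsHomogeneous 3)
    {x₀ : Fin n → k⸨X⸩} (hx₀ : ∀ i, absInf (x₀ i) ≤ 1) :
    ∃ M : ℝ, 1 ≤ M ∧ ∀ (Γ : ℤ) (w : Fin n → k⸨X⸩),
      ∫ γ in {γ : k⸨X⸩ | absInf γ < (Nat.card k : ℝ) ^ Γ}, ∫ x in box x₀ 0,
        psi p (phase P γ w x) ∂(haarPi k n) ∂(haar k) ≠ 0 →
      ∃ (γ : k⸨X⸩) (x : Fin n → k⸨X⸩) (r : ℝ), x ∈ box x₀ 0 ∧ 1 ≤ r ∧ absInf γ ≤ r ^ 2 ∧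
        r ^ 2 ≤ M * max 1 (absInf γ) ∧
        (∀ i, absInf (γ * eval x (pderiv i P) + w i) ≤ M * r) ∧ absInf (phase P γ w x) ≤ 1 := by
  obtain ⟨A, hA0, hA⟩ := exists_taylor_le (absVal k) P 1
  set q : ℝ := (Nat.card k : ℝ) with hq
  have hq1 : 1 < q := one_lt_card
  have hq0 : 0 < q := zero_lt_one.trans hq1
  obtain ⟨N, hN⟩ := pow_unbounded_of_one_lt A hq1
  refine ⟨q ^ (N + 1), one_le_pow₀ hq1.le, fun Γ w h => ?_⟩
  obtain ⟨γ, hγ⟩ := exists_scaling_average_ne_zero p hP hx₀ h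
  obtain ⟨m, hm1, hm2⟩ : ∃ m : ℕ, absInf γ ≤ (q ^ m) ^ 2 ∧
      (q ^ m) ^ 2 ≤ q ^ (N + 1) * max 1 (absInf γ) := by
    rcases le_total (absInf γ) 1 with h1 | h1
    · refine ⟨0, by simpa using h1, ?_⟩
      rw [pow_zero, one_pow, max_eq_left h1, mul_one]
      exact one_le_pow₀ hq1.le
    · have hγ0 : γ ≠ 0 := by
        rintro rfl
        rw [absInf_zero] at h1
        linarith
      rw [max_eq_right h1]
      rw [absInf_of_ne_zero hγ0] at h1 ⊢
      obtain ⟨K, hK⟩ : ∃ K : ℕ, -γ.order = K := by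
        refine ⟨(-γ.order).toNat, (Int.toNat_of_nonneg ?_).symm⟩
        by_contra! h2
        exact absurd h1 (not_le.2 (zpow_lt_one_of_neg₀ hq1 h2))
      rw [hK, zpow_natCast, ← hq]
      refine ⟨(K + 1) / 2, ?_, ?_⟩
      · rw [← pow_mul]
        exact pow_le_pow_right₀ hq1.le (by omega)
      · rw [← pow_mul, ← pow_add]
        exact pow_le_pow_right₀ hq1.le (by omega)
  obtain ⟨x, hx, hne⟩ := exists_translation_average_ne_zero p (M := -((m + (N + 1) : ℕ) : ℤ))
    (by omega) hγ
  have hx1 := absInf_le_one_of_mem_box hx₀ hx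
  set b : Fin n → k⸨X⸩ := fun i => γ * eval x (pderiv i P) + w i with hb
  have hlin : ∀ y ∈ (box 0 (-((m + (N + 1) : ℕ) : ℤ)) : Set (Fin n → k⸨X⸩)), ∀ s ∈ unitBall k,
      psi p ((1 + s) * phase P γ w (x + y)) =
        psi p ((1 + s) * (phase P γ w x + ∑ i, y i * b i)) := by
    intro y hy s hs
    have h1 : phase P γ w (x + y) = phase P γ w x + ∑ i, y i * b i +
        γ * (eval (x + y) P - eval x P - ∑ i, y i * eval x (pderiv i P)) := by
      have h2 : ∑ i, y i * b i = γ * ∑ i, y i * eval x (pderiv i P) + ∑ i, w i * y i := by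
        rw [Finset.mul_sum, ← Finset.sum_add_distrib]
        exact Finset.sum_congr rfl fun i _ => by rw [hb]; ring
      simp only [phase, h2, Pi.add_apply, mul_add, Finset.sum_add_distrib]
      ring
    have h3 := hA x y (q ^ (m + (N + 1)))⁻¹ hx1 (fun i => by
      have := hy i
      rw [zpow_neg, zpow_natCast, Pi.zero_apply, sub_zero] at this
      exact this.le) (by positivity) (inv_le_one_of_one_le₀ (one_le_pow₀ hq1.le))
    rw [absVal_apply] at h3
    rw [h1, mul_add, psi_add, psi_eq_one p (α := (1 + s) * (γ * _)), mul_one]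
    -- The Taylor error is smaller than `q⁻¹`, so that `ψ` is trivial on it.
    refine (absInf_lt_iff _ (-1)).1 ?_ 1 (by omega)
    rw [absInf_mul, absInf_one_add hs, one_mul, absInf_mul]
    calc absInf γ * _ ≤ (q ^ m) ^ 2 * (A * ((q ^ (m + (N + 1)))⁻¹) ^ 2) := by
          gcongr
          exact absInf_nonneg _
      _ = A * (q ^ N)⁻¹ * (q ^ (N + 2))⁻¹ := by
          field_simp
          ring
      _ < 1 * (q ^ (N + 2))⁻¹ := by
          gcongr
          rwa [← div_eq_mul_inv, div_lt_one (by positivity)]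
      _ ≤ q ^ (-1 : ℤ) := by
          rw [one_mul, zpow_neg_one]
          exact inv_anti₀ hq0 (le_self_pow₀ hq1.le (by omega))
  have hne' : ∫ y in box (0 : Fin n → k⸨X⸩) (-((m + (N + 1) : ℕ) : ℤ)), ∫ s in unitBall k,
      psi p ((1 + s) * (phase P γ w x + ∑ i, y i * b i)) ∂(haar k) ∂(haarPi k n) ≠ 0 := by
    convert hne using 1
    refine setIntegral_congr_fun (measurableSet_box _ _) fun y hy => ?_
    refine setIntegral_congr_fun isOpen_unitBall.measurableSet fun s hs => ?_
    exact (hlin y hy s hs).symm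
  obtain ⟨ha, hb'⟩ := small_of_integral_affine_ne_zero p hne'
  refine ⟨γ, x, q ^ m, hx, one_le_pow₀ hq1.le, hm1, hm2, fun i => ?_, ha⟩
  refine (hb' i).trans (le_of_eq ?_)
  rw [neg_neg, zpow_natCast, pow_add, mul_comm]

end Phase

/-! ### The weight function -/

section Weight

variable {k : Type*} [Field k] [Finite k] {n : ℕ}

omit [Finite k] in
theorem hessianInf_eq (F : MvPolynomial (Fin n) k[X]) (x : Fin n → k⸨X⸩) :
    hessianInf F x = hessianAt (map (polyEmb k) F) x := by
  ext i j
  simp [hessianInf, hessianAt, evalInf_eq, pderiv_map]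

/-- By compactness, a polynomial without zeros on a box is bounded away from zero there. -/
theorem exists_le_absInf_eval (P : MvPolynomial (Fin n) k⸨X⸩) {x₀ : Fin n → k⸨X⸩} {M : ℤ}
    (h : ∀ x ∈ box x₀ M, eval x P ≠ 0) :
    ∃ c : ℝ, 0 < c ∧ ∀ x ∈ box x₀ M, c ≤ absInf (eval x P) := by
  have hK := ((isCompact_box x₀ M).image (MvPolynomial.continuous_eval P)).isClosed
  obtain ⟨N, hN⟩ := exists_ball_subset (hK.isOpen_compl.mem_nhds (x := (0 : k⸨X⸩)) (by
    rintro ⟨x, hx, hx0⟩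
    exact h x hx hx0))
  refine ⟨(Nat.card k : ℝ) ^ N, zpow_pos (zero_lt_one.trans one_lt_card) _, fun x hx => ?_⟩
  by_contra! hlt
  exact hN hlt ⟨x, hx, rfl⟩

omit [Finite k] in
theorem setOf_supNorm_lt_eq_box [Nonempty (Fin n)] (x₀ : Fin n → k⸨X⸩) (M : ℤ) :
    {x | supNorm (x - x₀) < (Nat.card k : ℝ) ^ M} = box x₀ M := by
  ext x
  exact supNorm_lt_iff _ _

variable (p : ℕ) [Fact p.Prime] [Algebra (ZMod p) k]

theorem avgOscInt_indicator_box (F : MvPolynomial (Fin n) k[X]) (x₀ : Fin n → k⸨X⸩) (Γ : ℤ)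
    (w : Fin n → k⸨X⸩) :
    avgOscInt p F (Set.indicator (box x₀ 0) 1) Γ w =
      ∫ γ in {γ : k⸨X⸩ | absInf γ < (Nat.card k : ℝ) ^ Γ}, ∫ x in box x₀ 0,
        psi p (phase (map (polyEmb k) F) γ w x) ∂(haarPi k n) ∂(haar k) := by
  simp only [avgOscInt, oscInt]
  congr 1
  funext γ
  rw [← integral_indicator (measurableSet_box x₀ 0)]
  congr 1
  funext x
  by_cases hx : x ∈ box x₀ 0
  · simp [hx, phase, evalInf_eq]
  · simp [hx]

omit [Finite k] in
theorem two_ne_zero_of_three_lt (hp : 3 < p) : (2 : k⸨X⸩) ≠ 0 := by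
  let f : ZMod p →+* k⸨X⸩ := (HahnSeries.C : k →+* k⸨X⸩).comp (algebraMap (ZMod p) k)
  have h1 : (2 : ZMod p) ≠ 0 := by
    have : ((2 : ℕ) : ZMod p) ≠ 0 := by
      rw [Ne, ZMod.natCast_eq_zero_iff]
      exact fun h => absurd (Nat.le_of_dvd (by norm_num) h) (by omega)
    simpa using this
  rw [← map_ofNat f 2]
  exact (map_ne_zero f).2 h1

end Weight

end FFCubic

theorem lemma5p6 {k : Type*} [Field k] [Finite k] (p : ℕ) [Fact p.Prime] [Algebra (ZMod p) k]
    (hp : 3 < p) (n : ℕ) (F : MvPolynomial (Fin n) (Polynomial k)) (hF : F.IsHomogeneous 3)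
    (hns : FFCubic.IsNonsingular F) (D : MvPolynomial (Fin n) (Polynomial k))
    (hD : FFCubic.IsDualForm F D) (ω : (Fin n → LaurentSeries k) → ℝ)
    (hω : FFCubic.IsWeight F 0 ω) :
    ∃ C : ℝ, ∀ (Γ : ℤ) (w : Fin n → LaurentSeries k),
      FFCubic.avgOscInt p F ω Γ w ≠ 0 →
        FFCubic.absInf (FFCubic.evalInf D w) ≤
          C * (1 + FFCubic.supNorm w ^ ((D.totalDegree : ℤ) - 1)) := by
  open FFCubic in
  rcases Nat.eq_zero_or_eq_succ_pred D.totalDegree with hd | hd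
  · -- A constant dual form, which is all there is in at most one variable.
    rw [MvPolynomial.totalDegree_eq_zero_iff_eq_C] at hd
    refine ⟨absInf (polyEmb k (D.coeff 0)), fun Γ w _ => ?_⟩
    have h1 : evalInf D w = polyEmb k (D.coeff 0) := by
      conv_lhs => rw [hd]
      simp [evalInf]
    rw [h1]
    exact le_mul_of_one_le_right (absInf_nonneg _)
      (le_add_of_nonneg_right (zpow_nonneg (supNorm_nonneg w) _))
  have hd0 : D.totalDegree ≠ 0 := by omega
  have := nontrivial_of_totalDegree_ne_zero hD hF hns hd0
  obtain ⟨x₀, hx₀, hω1⟩ := hω.eq_indicator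
  have hx₀' : ∀ i, absInf (x₀ i) ≤ 1 := fun i => (absInf_le_supNorm x₀ i).trans hx₀
  rw [Nat.cast_zero, neg_zero, setOf_supNorm_lt_eq_box] at hω1
  have hPhom := hF.map (polyEmb k)
  have hDhom := hD.isHomogeneous.map (polyEmb k)
  rw [hd] at hDhom
  obtain ⟨Q, hQ⟩ := exists_eval_compGrad_eq polyEmb_injective hD hF hns hd0
  simp only [← MvPolynomial.pderiv_map] at hQ
  obtain ⟨c, hc, hcle⟩ := exists_le_absInf_eval (polyHessian (MvPolynomial.map (polyEmb k) F)).det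
    (x₀ := x₀) (M := 0) fun x hx => by
      rw [← det_hessianAt, ← hessianInf_eq]
      refine hω.hessian_det_ne_zero x ?_
      rw [hω1, Function.mem_support, Set.indicator_of_mem hx]
      exact one_ne_zero
  simp only [← det_hessianAt] at hcle
  obtain ⟨M, hM, hcrit⟩ := exists_approx_critical_point p hPhom hx₀'
  obtain ⟨C, hC⟩ := exists_eval_dual_le_of_approx_critical (absVal k) hPhom hDhom hQ
    (two_ne_zero_of_three_lt p hp) hc hM
  refine ⟨C, fun Γ w hne => ?_⟩
  rw [hω1, avgOscInt_indicator_box] at hne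
  obtain ⟨γ, x, r, hx, hr1, hγ1, hγ2, hgrad, hphase⟩ := hcrit Γ w hne
  have h1 := hC γ w x r (supNorm w) (absInf_le_one_of_mem_box hx₀' hx) (hcle x hx) hr1 hγ1 hγ2
    hgrad hphase (absInf_le_supNorm w) (supNorm_nonneg w)
  have h2 : ((D.totalDegree : ℤ) - 1) = (D.totalDegree.pred : ℕ) := by omega
  rw [h2, zpow_natCast, evalInf_eq]
  exact h1
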